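/- \textsc{Weighted Arc-Kayles} (WAK) is the following two-player game. A position is a finite undirected graph $G=(V,E)$ (loops allowed) together with a number of counters $\omega(v)\in\mathbb{N}$ on every vertex $v$. The players alternately select an edge $(u,v)\in E$ with $\omega(u)>0$ and $\omega(v)>0$ and remove one counter from each of its endpoints (a single counter if the edge is a loop); the player who makes the last move wins. The \emph{outcome} of a position says which of the two players, the next one to move or the other one, has a winning strategy. A tree has depth at most $2$ if it can be rooted at some vertex such that every vertex is joined to the root by a path with at most $2$ edges. \textbf{Theorem.} There is a polynomial-time algorithm computing the outcome of WAK on any loopless tree of depth at most $2$. Precisely: there are a (multi-stack) Turing machine $M$ and a polynomial $p$ such that, for every $n$, every loopless tree of depth at most $2$ on the vertices $0,\dots,n-1$ and every $\omega:\{0,\dots,n-1\}\to\mathbb{N}$, the machine $M$, started on the word of length $\ell$ that lists, for each vertex $i$, the number $\omega(i)$ in binary followed by the $i$-th row of the adjacency matrix, halts after at most $p(\ell)$ steps with the outcome of WAK on this weighted tree as its output. -/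

import Mathlib

namespace WAK

/-- A finite undirected graph in which loops are allowed (at most one edge between two vertices,
at most one loop at a vertex). -/
structure LoopGraph (V : Type) where
  /-- `adj u v` says that `(u, v)` is an edge; `adj u u` says that a loop is attached to `u` -/
  adj : V → V → Bool
  symm : ∀ u v, adj u v = adj v u

namespace LoopGraph

variable {V : Type}

/-- No vertex has a loop attached to it. -/
def Loopless (G : LoopGraph V) : Prop := ∀ v, G.adj v v = false

/-- The underlying simple graph, obtained by forgetting the loops. -/
def toSimpleGraph (G : LoopGraph V) : SimpleGraph V where
  Adj u v := u ≠ v ∧ G.adj u v = true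
  symm := ⟨fun u v h => ⟨h.1.symm, by rw [G.symm v u]; exact h.2⟩⟩
  loopless := ⟨fun _ h => h.1 rfl⟩

/-- `G` is a loopless tree. -/
def IsLooplessTree (G : LoopGraph V) : Prop := G.Loopless ∧ G.toSimpleGraph.IsTree

/-- For a suitable choice of the root `r`, every vertex is joined to `r` by a path with at most
`d` edges. For a tree: it has depth at most `d`. -/
def HasDepthAtMost (G : LoopGraph V) (d : ℕ) : Prop :=
  ∃ r : V, ∀ v : V, ∃ p : G.toSimpleGraph.Walk r v, p.IsPath ∧ p.length ≤ d

/-- The counters left after one counter has been removed from each endpoint of the edge `(u, v)`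
(one counter in total if `u = v`, that is, if the edge is a loop). -/
def play [DecidableEq V] (ω : V → ℕ) (u v : V) : V → ℕ := fun x => if x = u ∨ x = v then ω x - 1 else ω x

/-- `ω'` is an option of the position `ω` of Weighted Arc-Kayles on `G`: some edge both of whose
endpoints still carry a counter is selected. -/
def Move [DecidableEq V] (G : LoopGraph V) (ω ω' : V → ℕ) : Prop :=
  ∃ u v, G.adj u v = true ∧ 0 < ω u ∧ 0 < ω v ∧ ω' = play ω u v

theorem Move.sum_lt [Fintype V] [DecidableEq V] {G : LoopGraph V} {ω ω' : V → ℕ} (h : G.Move ω ω') :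
    ∑ v, ω' v < ∑ v, ω v := by
  obtain ⟨u, v, -, hu, -, rfl⟩ := h
  refine Finset.sum_lt_sum (fun x _ => ?_) ⟨u, Finset.mem_univ u, ?_⟩
  · unfold play; split <;> omega
  · unfold play; rw [if_pos (Or.inl rfl)]; omega

/-- The next player wins from `ω` (normal play): some option of `ω` is not a next-player win.
The recursion ends because each move lowers the total number of counters. -/
def NextPlayerWins [Fintype V] [DecidableEq V] (G : LoopGraph V) (ω : V → ℕ) : Prop :=
  ∃ ω', ∃ _ : G.Move ω ω', ¬ NextPlayerWins G ω'
termination_by ∑ v, ω v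
decreasing_by exact Move.sum_lt (by assumption)

theorem nextPlayerWins_iff [Fintype V] [DecidableEq V] (G : LoopGraph V) (ω : V → ℕ) :
    G.NextPlayerWins ω ↔ ∃ ω', G.Move ω ω' ∧ ¬ G.NextPlayerWins ω' := by
  rw [NextPlayerWins]; simp only [exists_prop]

end LoopGraph

/-- The two possible outcomes of a position of an impartial game. -/
inductive Outcome
  | nextWins
  | previousWins

/-- The outcome of Weighted Arc-Kayles on the graph `G` with `ω v` counters on the vertex `v`. -/
noncomputable def outcome {V : Type} [Fintype V] [DecidableEq V] (G : LoopGraph V) (ω : V → ℕ) :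
    Outcome :=
  letI := Classical.propDecidable (G.NextPlayerWins ω)
  if G.NextPlayerWins ω then Outcome.nextWins else Outcome.previousWins

/-- A weighted graph, with loops allowed, on the vertices `0, …, n - 1`. -/
structure Instance where
  n : ℕ
  graph : LoopGraph (Fin n)
  weight : Fin n → ℕ

open Computability in
/-- The input word of a weighted graph over the alphabet `bra, ket, comma, bit 0, bit 1, blank`:
for each vertex `i` in turn, the block `[w,a]` where `w` is the number of counters on `i` written
in binary (least significant bit first) and `a` is the `i`-th row of the adjacency matrix. -/
def Instance.encode (I : Instance) : List Γ' :=
  (List.finRange I.n).flatMap fun i =>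
    Γ'.bra :: (encodeNat (I.weight i)).map Γ'.bit ++
      Γ'.comma :: (List.finRange I.n).map (fun j => Γ'.bit (I.graph.adj i j)) ++ [Γ'.ket]

/-- The output word: the single bit `1` if the next player wins, the single bit `0` if the
previous player wins. -/
def Outcome.encode : Outcome → List Bool
  | .nextWins => [true]
  | .previousWins => [false]

/-- The instances on loopless trees of depth at most `2`. -/
abbrev DepthTwoTree : Type :=
  {I : Instance // I.graph.IsLooplessTree ∧ I.graph.HasDepthAtMost 2}

end WAK

/-! Weighted Arc-Kayles on trees of depth at most `2`, decided in polynomial time.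

*The game.* Root the tree at `r`, and let a child `i` of `r` carry `a` counters and the leaves below
it `b` counters in total. Every edge has exactly one end among the children of `r`, so each move
takes one counter from a child, and with it one counter either from `r` or from a leaf of this child.
Hence only the number `w = ω r` and the pairs `(a, b)` matter. The outcome depends on even less,
namely on `w`, on `A = ∑ a` over the children with `a ≤ b`, on `B = ∑ b` over the other children, and
on `e = ∑ (a - b)` over these other children: `PrevWins w A e B` is an explicit condition on
parities and the comparisons `e < w` and `A < w`. That no move leads from a position satisfying it to
another one (`PrevWins.not_root`, `PrevWins.not_leaf`) is linear arithmetic. That some move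
leads to it from every other position (`exists_move_of_not_prevWinsOn`) is shown by saying which
kind of child has to be played: one with `a ≤ b`, a leaf of one with `b < a`, or the root with one with
`b < a`. Together these give `LoopGraph.IsCenter.nextPlayerWins_iff`.

*The root.* A tree need not be handed over with its root, so all vertices `r` are tried. In a
loopless tree, `r` will do as soon as every edge joins a neighbour of `r` to a vertex that is not a
neighbour of `r` (`LoopGraph.isCenter_of_isTree`), a condition that can be read off from the adjacency
matrix, and that holds for some `r` if the depth is at most `2`
(`LoopGraph.exists_cross_of_hasDepthAtMost`).

*The machine.* Programs are written in a small structured language for machines with finitely many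
stacks (`Prog`), whose semantics `Runs` bounds the number of steps. Every program
is compiled to a machine of type `Turing.FinTM2` in such a way that each step of the program
is one step of the machine (`Runs.reachesIn`), which turns a program with a polynomial time bound
into a `TM2ComputableInPolyTime` (`Prog.computableInPolyTime`). The program `solve` runs three nested
loops over the vertices: over the candidates for the root, over its children `i`, and over the
vertices `j` below `i`. It never adds binary numbers. To compare `a` with `b`, the weights of the leaves
are subtracted one by one, truncated at `0`, from `a`; to compare `e` and `A` with `w`, the differences
`a - b` and the numbers `a` are subtracted from two copies of `w`. Truncated subtraction never
lengthens a number, so all numbers stay within the size of the input. Parities are kept in the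
finite memory. -/

namespace WAK

open Computability (Γ' encodeNat encodeNum encodePosNum)

/-! ### The outcome in terms of four numbers -/

/-- Contribution to `A` of a child with `a` counters whose leaves carry `b` counters in total:
if `a ≤ b`, the child can always be emptied without the root. -/
def freePart (a b : ℕ) : ℕ := if a ≤ b then a else 0

/-- Contribution to `B` of a child with `a` counters whose leaves carry `b` counters in total. -/
def leafPart (a b : ℕ) : ℕ := if a ≤ b then 0 else b

/-- The positions won by the previous player: `w` is the number of counters on the root, `A` the
sum of `freePart`, `e` the sum of the truncated differences `a - b`, and `B` the sum of `leafPart`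
over the children of the root. Thus `A + e + B` is the number of counters on the children, which each
move lowers by one, and `e` is the least number of counters of the root that are needed to remove
all of them. If `e < w`, only the parity of `A + e + B` matters. -/
def PrevWins (w A e B : ℕ) : Prop :=
  if e < w then (A + e + B) % 2 = 0
  else if B % 2 = 0 then A % 2 = 0 ∧ w % 2 = 0
  else A % 2 ≠ w % 2 ∧ (A % 2 = 0 ↔ A < w)

theorem PrevWins.not_root {w A e B a b : ℕ} (hw : 0 < w) (ha : 0 < a)
    (h : PrevWins w (A + freePart a b) (e + (a - b)) (B + leafPart a b)) :
    ¬ PrevWins (w - 1) (A + freePart (a - 1) b) (e + (a - 1 - b)) (B + leafPart (a - 1) b) := by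
  unfold PrevWins freePart leafPart at *
  split_ifs at * <;> omega

theorem PrevWins.not_leaf {w A e B a b : ℕ} (ha : 0 < a) (hb : 0 < b)
    (h : PrevWins w (A + freePart a b) (e + (a - b)) (B + leafPart a b)) :
    ¬ PrevWins w (A + freePart (a - 1) (b - 1)) (e + (a - 1 - (b - 1)))
      (B + leafPart (a - 1) (b - 1)) := by
  unfold PrevWins freePart leafPart at *
  split_ifs at * <;> omega

/-- The positions in which a child that can be emptied without the root is to be played. -/
def FreeMoveCond (w A e B : ℕ) : Prop :=
  0 < A ∧ (e < w ∨ (B % 2 = 0 ∧ A % 2 = 1) ∨ (B % 2 = 1 ∧ A % 2 = 0 ∧ w % 2 = 1) ∨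
    (B % 2 = 1 ∧ A % 2 = 1 ∧ (w % 2 = 0 ∨ A ≤ w)))

/-- The positions in which a counter of a leaf in short supply is to be played. -/
def LeafMoveCond (w A e B : ℕ) : Prop :=
  0 < B ∧ (e < w ∨ (B % 2 = 1 ∧ A % 2 = 0 ∧ w % 2 = 0) ∨
    (B % 2 = 0 ∧ A % 2 = 0 ∧ w % 2 = 1 ∧ A < w))

theorem exists_free_move {w A e B : ℕ} (h : ¬ PrevWins w A e B) (hc : FreeMoveCond w A e B) :
    (0 < w ∧ PrevWins (w - 1) (A - 1) e B) ∨ PrevWins w (A - 1) e B := by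
  obtain ⟨hA, hc⟩ := hc
  have h1 : B % 2 = 0 ∨ B % 2 = 1 := by omega
  by_cases hw : e < w
  · refine Or.inr ?_
    rw [PrevWins, if_pos hw] at *
    omega
  by_cases hr : (B % 2 = 0 ∧ w % 2 = 1) ∨ (B % 2 = 1 ∧ (A % 2 = 0 ∨ w % 2 = 0))
  · left
    rw [PrevWins, if_neg hw] at h
    rw [PrevWins, if_neg (by omega)]
    split_ifs at * <;> omega
  · right
    rw [PrevWins, if_neg hw] at *
    split_ifs at * <;> omega

theorem leaf_move {w A e B : ℕ} (h : ¬ PrevWins w A e B) (hc : LeafMoveCond w A e B) :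
    PrevWins w A e (B - 1) := by
  obtain ⟨hB, hc⟩ := hc
  by_cases hw : e < w
  · rw [PrevWins, if_pos hw] at *
    omega
  rw [PrevWins, if_neg hw] at *
  split_ifs at * <;> omega

/-- If neither of the previous two kinds of moves is called for, the root is played together with
a child in short supply. The pair `A', B'` stands for the values after the move; the parity of `B`
can be forced to change only if every such child is one counter short and has an odd supply. -/
theorem root_move {w A e B A' B' : ℕ} (h : ¬ PrevWins w A e B) (hf : ¬ FreeMoveCond w A e B)
    (hl : ¬ LeafMoveCond w A e B) (hAB : A' + B' = A + B) (hA' : A ≤ A')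
    (hp : B' % 2 = B % 2 ∨ (e % 2 = B % 2 ∧ A < A')) :
    PrevWins (w - 1) A' (e - 1) B' := by
  by_cases hw : e < w
  · have hA0 : A = 0 := by
      by_contra h0
      exact hf ⟨by omega, Or.inl hw⟩
    have hB0 : B = 0 := by
      by_contra h0
      exact hl ⟨by omega, Or.inl hw⟩
    subst hA0 hB0
    obtain rfl : A' = 0 := by omega
    obtain rfl : B' = 0 := by omega
    rw [PrevWins, if_pos hw] at h
    rw [PrevWins, if_pos (by omega)]
    omega
  rw [PrevWins, if_neg hw] at h
  rw [PrevWins, if_neg (by omega)]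
  unfold FreeMoveCond at hf
  unfold LeafMoveCond at hl
  have hA2 := Nat.mod_two_eq_zero_or_one A
  have hB2 := Nat.mod_two_eq_zero_or_one B
  rcases hA2 with hA2 | hA2 <;> rcases hB2 with hB2 | hB2 <;> simp [hA2, hB2] at h hf hl hp <;>
    split_ifs <;> omega

section Sums

variable {V : Type} [DecidableEq V]

theorem sum_eq_erase_add {C : Finset V} {i : V} (hi : i ∈ C) (f : ℕ → ℕ → ℕ) (a b a' b' : V → ℕ)
    (h : ∀ k ∈ C, k ≠ i → a' k = a k ∧ b' k = b k) :
    ∑ k ∈ C, f (a' k) (b' k) = ∑ k ∈ C.erase i, f (a k) (b k) + f (a' i) (b' i) := by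
  rw [← Finset.sum_erase_add _ _ hi]
  congr 1
  refine Finset.sum_congr rfl fun k hk => ?_
  obtain ⟨h1, h2⟩ := h k (Finset.mem_of_mem_erase hk) (Finset.ne_of_mem_erase hk)
  rw [h1, h2]

/-- `PrevWins` for the data of a whole family `C` of children. -/
def PrevWinsOn (C : Finset V) (w : ℕ) (a b : V → ℕ) : Prop :=
  PrevWins w (∑ i ∈ C, freePart (a i) (b i)) (∑ i ∈ C, (a i - b i)) (∑ i ∈ C, leafPart (a i) (b i))

theorem prevWinsOn_iff {C : Finset V} {i : V} (hi : i ∈ C) (w : ℕ) (a b a' b' : V → ℕ)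
    (h : ∀ k ∈ C, k ≠ i → a' k = a k ∧ b' k = b k) :
    PrevWinsOn C w a' b' ↔
      PrevWins w (∑ k ∈ C.erase i, freePart (a k) (b k) + freePart (a' i) (b' i))
        (∑ k ∈ C.erase i, (a k - b k) + (a' i - b' i))
        (∑ k ∈ C.erase i, leafPart (a k) (b k) + leafPart (a' i) (b' i)) := by
  rw [PrevWinsOn, sum_eq_erase_add hi freePart a b a' b' h,
    sum_eq_erase_add hi (fun x y => x - y) a b a' b' h, sum_eq_erase_add hi leafPart a b a' b' h]

/-- From a position that does not satisfy `PrevWins` one can move, with a counter of the root or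
with a counter of a leaf, to one that does. -/
theorem exists_move_of_not_prevWinsOn {C : Finset V} {w : ℕ} {a b : V → ℕ}
    (h : ¬ PrevWinsOn C w a b) :
    ∃ i ∈ C, 0 < a i ∧
      ((0 < w ∧ PrevWins (w - 1) (∑ k ∈ C.erase i, freePart (a k) (b k) + freePart (a i - 1) (b i))
        (∑ k ∈ C.erase i, (a k - b k) + (a i - 1 - b i))
        (∑ k ∈ C.erase i, leafPart (a k) (b k) + leafPart (a i - 1) (b i))) ∨
      (0 < b i ∧ PrevWins w (∑ k ∈ C.erase i, freePart (a k) (b k) + freePart (a i - 1) (b i - 1))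
        (∑ k ∈ C.erase i, (a k - b k) + (a i - 1 - (b i - 1)))
        (∑ k ∈ C.erase i, leafPart (a k) (b k) + leafPart (a i - 1) (b i - 1)))) := by
  have key : ∀ i ∈ C, ¬ PrevWins w (∑ k ∈ C.erase i, freePart (a k) (b k) + freePart (a i) (b i))
        (∑ k ∈ C.erase i, (a k - b k) + (a i - b i))
        (∑ k ∈ C.erase i, leafPart (a k) (b k) + leafPart (a i) (b i)) := fun i hi =>
    (prevWinsOn_iff hi w a b a b fun _ _ _ => ⟨rfl, rfl⟩).not.1 h
  have hA : ∀ i ∈ C, ∑ k ∈ C.erase i, freePart (a k) (b k) + freePart (a i) (b i)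
      = ∑ k ∈ C, freePart (a k) (b k) := fun i hi => Finset.sum_erase_add _ _ hi
  have he : ∀ i ∈ C, ∑ k ∈ C.erase i, (a k - b k) + (a i - b i)
      = ∑ k ∈ C, (a k - b k) := fun i hi => Finset.sum_erase_add _ _ hi
  have hB : ∀ i ∈ C, ∑ k ∈ C.erase i, leafPart (a k) (b k) + leafPart (a i) (b i)
      = ∑ k ∈ C, leafPart (a k) (b k) := fun i hi => Finset.sum_erase_add _ _ hi
  unfold PrevWinsOn at h
  have hApos : 0 < ∑ k ∈ C, freePart (a k) (b k) → ∃ i ∈ C, 0 < a i ∧ a i ≤ b i := by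
    intro hp
    obtain ⟨i, hi, h0⟩ := Finset.exists_ne_zero_of_sum_ne_zero hp.ne'
    refine ⟨i, hi, ?_⟩
    unfold freePart at h0
    split_ifs at h0 <;> omega
  have hBpos : 0 < ∑ k ∈ C, leafPart (a k) (b k) → ∃ i ∈ C, 0 < b i ∧ b i < a i := by
    intro hp
    obtain ⟨i, hi, h0⟩ := Finset.exists_ne_zero_of_sum_ne_zero hp.ne'
    refine ⟨i, hi, ?_⟩
    unfold leafPart at h0
    split_ifs at h0 <;> omega
  have hepos : 0 < ∑ k ∈ C, (a k - b k) → ∃ i ∈ C, b i < a i := by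
    intro hp
    obtain ⟨i, hi, h0⟩ := Finset.exists_ne_zero_of_sum_ne_zero hp.ne'
    exact ⟨i, hi, by omega⟩
  -- A child on which a root move lowers `e` without changing the parities of `A` and `B`.
  have hgood : (∃ i ∈ C, b i < a i ∧ (b i + 1 < a i ∨ b i % 2 = 0)) ∨
      ((∀ i ∈ C, b i < a i → a i = b i + 1 ∧ b i % 2 = 1) ∧
      (∑ k ∈ C, (a k - b k) + ∑ k ∈ C, leafPart (a k) (b k)) % 2 = 0) := by
    by_cases hg : ∃ i ∈ C, b i < a i ∧ (b i + 1 < a i ∨ b i % 2 = 0)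
    · exact Or.inl hg
    · push Not at hg
      refine Or.inr ⟨fun i hi hlt => ?_, ?_⟩
      · have := hg i hi hlt
        omega
      · rw [← Finset.sum_add_distrib]
        refine Nat.mod_eq_zero_of_dvd (Finset.dvd_sum fun i hi => ?_)
        have := hg i hi
        unfold leafPart
        split_ifs <;> omega
  generalize hAe : ∑ k ∈ C, freePart (a k) (b k) = A at *
  generalize hee : ∑ k ∈ C, (a k - b k) = e at *
  generalize hBe : ∑ k ∈ C, leafPart (a k) (b k) = B at *
  by_cases hf : FreeMoveCond w A e B
  · obtain ⟨i, hi, ha, hab⟩ := hApos hf.1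
    refine ⟨i, hi, ha, ?_⟩
    have h1 := hA i hi; have h2 := he i hi; have h3 := hB i hi
    have hx : ∀ x, a i - 1 ≤ x → freePart (a i - 1) x = a i - 1 ∧ leafPart (a i - 1) x = 0 :=
      fun x hx => ⟨if_pos hx, if_pos hx⟩
    rw [(hx (b i) (by omega)).1, (hx (b i) (by omega)).2, (hx (b i - 1) (by omega)).1,
      (hx (b i - 1) (by omega)).2]
    rw [freePart, if_pos hab] at h1
    rw [leafPart, if_pos hab] at h3
    have h4 : ∑ k ∈ C.erase i, freePart (a k) (b k) + (a i - 1) = A - 1 := by omega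
    have h5 : ∑ k ∈ C.erase i, (a k - b k) + (a i - 1 - b i) = e := by omega
    have h6 : ∑ k ∈ C.erase i, (a k - b k) + (a i - 1 - (b i - 1)) = e := by omega
    rw [h4, h5, h6, h3]
    exact (exists_free_move h hf).imp id fun h => ⟨by omega, h⟩
  by_cases hl : LeafMoveCond w A e B
  · obtain ⟨i, hi, hb, hab⟩ := hBpos hl.1
    refine ⟨i, hi, by omega, Or.inr ⟨hb, ?_⟩⟩
    have h1 := hA i hi; have h2 := he i hi; have h3 := hB i hi
    rw [freePart, if_neg (by omega)] at h1 ⊢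
    rw [leafPart, if_neg (by omega)] at h3 ⊢
    rw [h1, show a i - 1 - (b i - 1) = a i - b i by omega, h2,
      show ∑ k ∈ C.erase i, leafPart (a k) (b k) + (b i - 1) = B - 1 by omega]
    exact leaf_move h hl
  have hwe : 0 < w ∧ 0 < e := by
    unfold PrevWins at h
    unfold FreeMoveCond at hf
    unfold LeafMoveCond at hl
    split_ifs at h <;> omega
  have hroot : ∀ i ∈ C, b i < a i → ((b i + 1 < a i ∨ b i % 2 = 0) ∨ (b i % 2 = 1 ∧ e % 2 = B % 2)) →
      PrevWins (w - 1) (∑ k ∈ C.erase i, freePart (a k) (b k) + freePart (a i - 1) (b i))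
        (∑ k ∈ C.erase i, (a k - b k) + (a i - 1 - b i))
        (∑ k ∈ C.erase i, leafPart (a k) (b k) + leafPart (a i - 1) (b i)) := by
    intro i hi hab hh
    have h1 := hA i hi; have h2 := he i hi; have h3 := hB i hi
    rw [freePart, if_neg (by omega)] at h1
    rw [leafPart, if_neg (by omega)] at h3
    rw [show ∑ k ∈ C.erase i, (a k - b k) + (a i - 1 - b i) = e - 1 by omega]
    unfold freePart leafPart at *
    apply root_move h hf hl <;> split_ifs <;> omega
  obtain ⟨i, hi, hab, hh⟩ | ⟨hall, hpar⟩ := hgood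
  · exact ⟨i, hi, by omega, Or.inl ⟨hwe.1, hroot i hi hab (Or.inl hh)⟩⟩
  · obtain ⟨i, hi, hab⟩ := hepos hwe.2
    have hh := hall i hi hab
    exact ⟨i, hi, by omega, Or.inl ⟨hwe.1, hroot i hi hab (Or.inr ⟨hh.2, by omega⟩)⟩⟩

end Sums

/-! ### The game around a center -/

namespace LoopGraph

variable {V : Type}

/-- Every edge joins a neighbour of `r` to a vertex that is not a neighbour of `r`, and a vertex
other than `r` has at most one common neighbour with `r`. In a tree this says that every vertex is
within distance `2` of `r`. -/
structure IsCenter (G : LoopGraph V) (r : V) : Prop where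
  cross : ∀ u v, G.adj u v = true → G.adj r u ≠ G.adj r v
  uniq : ∀ i k j, G.adj r i = true → G.adj r k = true → G.adj i j = true → G.adj k j = true →
    j ≠ r → i = k

/-- The neighbours of `r`. -/
def children [Fintype V] (G : LoopGraph V) (r : V) : Finset V := {i | G.adj r i = true}

/-- The number of counters on the neighbours of `i` other than `r`. -/
def below [Fintype V] [DecidableEq V] (G : LoopGraph V) (r : V) (ω : V → ℕ) (i : V) : ℕ :=
  ∑ j, if G.adj i j = true ∧ j ≠ r then ω j else 0

theorem play_comm [DecidableEq V] (ω : V → ℕ) (u v : V) : play ω u v = play ω v u := by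
  funext x
  simp only [play, or_comm]

variable {G : LoopGraph V} {r : V}

theorem mem_children [Fintype V] {i : V} : i ∈ G.children r ↔ G.adj r i = true := by simp [children]

theorem IsCenter.not_mem_children_self (hc : G.IsCenter r) : G.adj r r = false := by
  by_contra h
  exact hc.cross r r (by simpa using h) rfl

variable [Fintype V] [DecidableEq V]

/-- Effect of playing an edge between the center and one of its neighbours. -/
theorem IsCenter.play_root (hc : G.IsCenter r) (ω : V → ℕ) {i : V} (hi : G.adj r i = true) :
    play ω i r r = ω r - 1 ∧ play ω i r i = ω i - 1 ∧
    (∀ k, G.adj r k = true → k ≠ i → play ω i r k = ω k) ∧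
    (∀ k, G.adj r k = true → G.below r (play ω i r) k = G.below r ω k) := by
  have hr := hc.not_mem_children_self
  refine ⟨by simp [play], by simp [play], fun k hk hne => ?_, fun k hk => ?_⟩
  · have : k ≠ r := by rintro rfl; simp [hr] at hk
    simp [play, hne, this]
  · refine Finset.sum_congr rfl fun j _ => ?_
    split_ifs with h
    · have hj : j ≠ i := by
        rintro rfl
        exact hc.cross k j h.1 (hk.trans hi.symm)
      simp [play, hj, h.2]
    · rfl

/-- Effect of playing an edge between a neighbour of the center and a leaf below it. -/
theorem IsCenter.play_leaf (hc : G.IsCenter r) (ω : V → ℕ) {i j : V} (hi : G.adj r i = true)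
    (hij : G.adj i j = true) (hj : j ≠ r) (hpos : 0 < ω j) :
    play ω i j r = ω r ∧ play ω i j i = ω i - 1 ∧
    (∀ k, G.adj r k = true → k ≠ i → play ω i j k = ω k) ∧
    (∀ k, G.adj r k = true → k ≠ i → G.below r (play ω i j) k = G.below r ω k) ∧
    G.below r (play ω i j) i = G.below r ω i - 1 := by
  have hr := hc.not_mem_children_self
  have hrj : G.adj r j = false := by
    have := hc.cross i j hij
    rw [hi] at this
    simpa using this.symm
  have hir : r ≠ i := by rintro rfl; simp [hr] at hi
  refine ⟨by simp [play, hir, hj.symm], by simp [play], fun k hk hne => ?_, fun k hk hne => ?_, ?_⟩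
  · have : k ≠ j := by rintro rfl; simp [hrj] at hk
    simp [play, hne, this]
  · refine Finset.sum_congr rfl fun l _ => ?_
    split_ifs with h
    · have h1 : l ≠ i := by
        rintro rfl
        exact hc.cross k l h.1 (hk.trans hi.symm)
      have h2 : l ≠ j := by
        rintro rfl
        exact hne (hc.uniq k i l hk hi h.1 hij h.2)
      simp [play, h1, h2]
    · rfl
  · unfold below
    rw [← Finset.add_sum_erase _ _ (Finset.mem_univ j), ← Finset.add_sum_erase _ _ (Finset.mem_univ j),
      if_pos ⟨hij, hj⟩, if_pos ⟨hij, hj⟩]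
    have : ∀ l ∈ Finset.univ.erase j, (if G.adj i l = true ∧ l ≠ r then play ω i j l else 0) =
        if G.adj i l = true ∧ l ≠ r then ω l else 0 := by
      intro l hl
      split_ifs with h
      · have h1 : l ≠ i := by
          rintro rfl
          exact hc.cross l l h.1 rfl
        simp [play, h1, Finset.ne_of_mem_erase hl]
      · rfl
    rw [Finset.sum_congr rfl this]
    simp only [play, or_true, if_true]
    omega

theorem IsCenter.prevWinsOn_play_root (hc : G.IsCenter r) (ω : V → ℕ) {i : V}
    (hi : G.adj r i = true) :
    PrevWinsOn (G.children r) (play ω i r r) (play ω i r) (G.below r (play ω i r)) ↔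
      PrevWins (ω r - 1)
        (∑ k ∈ (G.children r).erase i, freePart (ω k) (G.below r ω k) +
          freePart (ω i - 1) (G.below r ω i))
        (∑ k ∈ (G.children r).erase i, (ω k - G.below r ω k) + (ω i - 1 - G.below r ω i))
        (∑ k ∈ (G.children r).erase i, leafPart (ω k) (G.below r ω k) +
          leafPart (ω i - 1) (G.below r ω i)) := by
  obtain ⟨h1, h2, h3, h4⟩ := hc.play_root ω hi
  have := prevWinsOn_iff (mem_children.2 hi) (play ω i r r) ω (G.below r ω) (play ω i r)
    (G.below r (play ω i r)) fun k hk hne => ⟨h3 k (mem_children.1 hk) hne, h4 k (mem_children.1 hk)⟩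
  rw [h1] at this ⊢
  rwa [h2, h4 i hi] at this

theorem IsCenter.prevWinsOn_play_leaf (hc : G.IsCenter r) (ω : V → ℕ) {i j : V}
    (hi : G.adj r i = true) (hij : G.adj i j = true) (hj : j ≠ r) (hpos : 0 < ω j) :
    PrevWinsOn (G.children r) (play ω i j r) (play ω i j) (G.below r (play ω i j)) ↔
      PrevWins (ω r)
        (∑ k ∈ (G.children r).erase i, freePart (ω k) (G.below r ω k) +
          freePart (ω i - 1) (G.below r ω i - 1))
        (∑ k ∈ (G.children r).erase i, (ω k - G.below r ω k) + (ω i - 1 - (G.below r ω i - 1)))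
        (∑ k ∈ (G.children r).erase i, leafPart (ω k) (G.below r ω k) +
          leafPart (ω i - 1) (G.below r ω i - 1)) := by
  obtain ⟨h1, h2, h3, h4, h5⟩ := hc.play_leaf ω hi hij hj hpos
  have := prevWinsOn_iff (mem_children.2 hi) (play ω i j r) ω (G.below r ω) (play ω i j)
    (G.below r (play ω i j))
    fun k hk hne => ⟨h3 k (mem_children.1 hk) hne, h4 k (mem_children.1 hk) hne⟩
  rw [h1] at this ⊢
  rwa [h2, h5] at this

/-- The outcome on a graph with a center, for every distribution of the counters. -/
theorem IsCenter.nextPlayerWins_iff (hc : G.IsCenter r) (ω : V → ℕ) :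
    G.NextPlayerWins ω ↔ ¬ PrevWinsOn (G.children r) (ω r) ω (G.below r ω) := by
  induction hn : ∑ v, ω v using Nat.strong_induction_on generalizing ω with
  | _ n ih =>
  have ih' : ∀ ω', G.Move ω ω' →
      (G.NextPlayerWins ω' ↔ ¬ PrevWinsOn (G.children r) (ω' r) ω' (G.below r ω')) :=
    fun ω' hm => ih _ (hn ▸ hm.sum_lt) ω' rfl
  rw [LoopGraph.nextPlayerWins_iff]
  constructor
  · rintro ⟨ω', hm, hlose⟩ hP
    rw [ih' ω' hm, not_not] at hlose
    -- exactly one endpoint of the chosen edge is a neighbour of the center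
    have : ∃ i j, G.adj r i = true ∧ G.adj i j = true ∧ 0 < ω i ∧ 0 < ω j ∧ ω' = play ω i j := by
      obtain ⟨u, v, huv, hu, hv, rfl⟩ := hm
      have hx := hc.cross u v huv
      cases hru : G.adj r u
      · exact ⟨v, u, by simpa [hru] using hx.symm, by rw [G.symm]; exact huv, hv, hu, play_comm ..⟩
      · exact ⟨u, v, hru, huv, hu, hv, rfl⟩
    obtain ⟨i, j, hi, hij, hposi, hposj, rfl⟩ := this
    have hP' := (prevWinsOn_iff (mem_children.2 hi) (ω r) ω (G.below r ω) ω (G.below r ω)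
      fun _ _ _ => ⟨rfl, rfl⟩).1 hP
    by_cases hj : j = r
    · subst hj
      exact hP'.not_root hposj hposi ((hc.prevWinsOn_play_root ω hi).1 hlose)
    · have hb : 0 < G.below r ω i := by
        refine hposj.trans_le ?_
        have := Finset.single_le_sum (f := fun j => if G.adj i j = true ∧ j ≠ r then ω j else 0)
          (fun _ _ => Nat.zero_le _) (Finset.mem_univ j)
        simpa [hij, hj, below] using this
      exact hP'.not_leaf hposi hb ((hc.prevWinsOn_play_leaf ω hi hij hj hposj).1 hlose)
  · intro hP
    obtain ⟨i, hi, hposi, ⟨hw, h⟩ | ⟨hb, h⟩⟩ := exists_move_of_not_prevWinsOn hP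
    · have hi := mem_children.1 hi
      have hm : G.Move ω (play ω i r) := ⟨i, r, by rw [G.symm]; exact hi, hposi, hw, rfl⟩
      exact ⟨_, hm, by rw [ih' _ hm, not_not]; exact (hc.prevWinsOn_play_root ω hi).2 h⟩
    · have hi := mem_children.1 hi
      obtain ⟨j, -, hj⟩ := Finset.exists_ne_zero_of_sum_ne_zero hb.ne'
      obtain ⟨⟨hij, hjr⟩, hpos⟩ : (G.adj i j = true ∧ j ≠ r) ∧ ω j ≠ 0 := by simpa [and_assoc] using hj
      have hpos : 0 < ω j := Nat.pos_of_ne_zero hpos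
      have hm : G.Move ω (play ω i j) := ⟨i, j, hij, hposi, hpos, rfl⟩
      exact ⟨_, hm, by rw [ih' _ hm, not_not]; exact (hc.prevWinsOn_play_leaf ω hi hij hjr hpos).2 h⟩

/-! ### Centers of trees -/

theorem path_eq_of_isTree {V : Type} {G : LoopGraph V} (hG : G.IsLooplessTree) {u v : V}
    {p q : G.toSimpleGraph.Walk u v} (hp : p.IsPath) (hq : q.IsPath) : p = q :=
  congrArg Subtype.val ((hG.2.isAcyclic.subsingleton_path u v).elim ⟨p, hp⟩ ⟨q, hq⟩)

/-- In a tree, a vertex whose edges all go between its neighbours and the rest is a center. -/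
theorem isCenter_of_isTree {V : Type} {G : LoopGraph V} {r : V} (hG : G.IsLooplessTree)
    (h : ∀ u v, G.adj u v = true → G.adj r u ≠ G.adj r v) : G.IsCenter r := by
  refine ⟨h, fun i k j hi hk hij hkj hj => ?_⟩
  have hne : ∀ {u v}, G.adj u v = true → u ≠ v := by
    rintro u v huv rfl
    simp [hG.1 u] at huv
  have walk : ∀ i, G.adj r i = true → G.adj i j = true →
      ∃ p : G.toSimpleGraph.Walk r j, p.IsPath ∧ p.support = [r, i, j] := by
    intro i hi hij
    have h1 : G.toSimpleGraph.Adj r i := ⟨hne hi, hi⟩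
    have h2 : G.toSimpleGraph.Adj i j := ⟨hne hij, hij⟩
    refine ⟨.cons h1 (.cons h2 .nil), ?_, rfl⟩
    rw [SimpleGraph.Walk.isPath_def]
    simp [hne hi, hne hij, hj.symm]
  obtain ⟨p, hp, hps⟩ := walk i hi hij
  obtain ⟨q, hq, hqs⟩ := walk k hk hkj
  rw [path_eq_of_isTree hG hp hq, hqs] at hps
  simpa using hps.symm

/-- The root of a tree of depth at most `2` is a center. -/
theorem exists_cross_of_hasDepthAtMost {V : Type} {G : LoopGraph V} (hG : G.IsLooplessTree)
    (hd : G.HasDepthAtMost 2) : ∃ r, ∀ u v, G.adj u v = true → G.adj r u ≠ G.adj r v := by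
  obtain ⟨r, hr⟩ := hd
  refine ⟨r, fun u v huv heq => ?_⟩
  have hne : ∀ {u v}, G.adj u v = true → u ≠ v := by
    rintro u v huv rfl
    simp [hG.1 u] at huv
  have hadj : ∀ {u v}, G.adj u v = true → G.toSimpleGraph.Adj u v := fun h => ⟨hne h, h⟩
  have huniq : ∀ {x} (p q : G.toSimpleGraph.Walk r x), p.IsPath → q.IsPath → p.support = q.support :=
    fun p q hp hq => by rw [path_eq_of_isTree hG hp hq]
  cases hru : G.adj r u
  · have hrv : G.adj r v = false := heq ▸ hru
    have hur : u ≠ r := by rintro rfl; simp [huv] at hrv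
    have hvr : v ≠ r := by rintro rfl; rw [G.symm, huv] at hru; simp at hru
    have hmid : ∀ x, x ≠ r → G.adj r x = false → ∃ c, G.adj r c = true ∧ G.adj c x = true := by
      intro x hx hrx
      obtain ⟨p, -, hp⟩ := hr x
      match p, hp with
      | .nil, _ => exact absurd rfl hx
      | .cons h .nil, _ => simp [h.2] at hrx
      | .cons h (.cons h' .nil), _ => exact ⟨_, h.2, h'.2⟩
      | .cons h (.cons h' (.cons h'' p)), hp => simp at hp
    obtain ⟨c, hrc, hcu⟩ := hmid u hur hru
    obtain ⟨d, hrd, hdv⟩ := hmid v hvr hrv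
    have hcv : c ≠ v := by rintro rfl; simp [hrc] at hrv
    have := huniq (.cons (hadj hrc) (.cons (hadj hcu) (.cons (hadj huv) .nil)))
      (.cons (hadj hrd) (.cons (hadj hdv) .nil))
      (by rw [SimpleGraph.Walk.isPath_def]; simp [hne hrc, hur.symm, hvr.symm, hne hcu, hcv, hne huv])
      (by rw [SimpleGraph.Walk.isPath_def]; simp [hne hrd, hvr.symm, hne hdv])
    simpa using congrArg List.length this
  · have hrv : G.adj r v = true := heq ▸ hru
    have := huniq (.cons (hadj hru) (.cons (hadj huv) .nil)) (.cons (hadj hrv) .nil)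
      (by rw [SimpleGraph.Walk.isPath_def]; simp [hne hru, hne hrv, hne huv])
      (by rw [SimpleGraph.Walk.isPath_def]; simp [hne hrv])
    simpa using congrArg List.length this

end LoopGraph

/-! ### A structured language for stack machines -/

/-- The stacks of the machine, apart from its output stack: the input `inp`; the descriptions of the
vertices still to be read in the loops over the roots, the children and the leaves (`l1`, `l2`, `l3`)
and backups of what has been read (`b2`, `b3`); the number of roots already tried in unary (`u`, `ub`);
the row of the root (`r`, `ri`, `rb`) and of the child (`q`); the number `a` of counters on the child
and what is left of it (`x`); what is left of the number of counters on the root after subtracting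
`a - b` (`y`) or `a` (`z`); the number of counters on a leaf (`w`); two scratch stacks (`t`, `n`). -/
inductive Stk
  | inp | l1 | l2 | l3 | b2 | b3 | t | u | ub | r | ri | rb | q | x | y | z | a | n | w
  deriving DecidableEq

instance : Fintype Stk where
  elems := {.inp, .l1, .l2, .l3, .b2, .b3, .t, .u, .ub, .r, .ri, .rb, .q, .x, .y, .z, .a, .n, .w}
  complete k := by cases k <;> decide

/-- The registers that are overwritten freely: the last symbol read by a loop, two more symbols,
and a borrow. -/
structure Tmp where
  buf : Option Γ' := none
  c1 : Option Γ' := none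
  c2 : Option Γ' := none
  bor : Bool := false
  deriving Fintype

/-- The finite memory of the machine: whether the root has passed the test so far (`ok`); the
outcome found so far (`res`); whether the current vertex is a child of the root (`ci`); the parities of
the numbers of counters on it and below it (`pa`, `pb`); the parities of `A`, `B` and `A + e + B`
(`pA`, `pB`, `pQ`) and of the number of counters on the root (`pw`); whether that number is larger than
`e` (`fy`) or than `A` (`fz`); whether the current leaf is to be counted (`sub`); whether a number is
nonzero (`nz`). -/
structure Reg where
  ok : Bool := false
  res : Bool := false
  ci : Bool := false
  pa : Bool := false
  pb : Bool := false
  pA : Bool := false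
  pB : Bool := false
  pQ : Bool := false
  pw : Bool := false
  fy : Bool := false
  fz : Bool := false
  sub : Bool := false
  nz : Bool := false
  tmp : Tmp := {}

noncomputable instance : Fintype Reg :=
  Fintype.ofInjective (fun v : Reg => ((v.ok, v.res, v.ci, v.pa, v.pb),
    (v.pA, v.pB, v.pQ, v.pw, v.fy, v.fz, v.sub, v.nz), v.tmp)) fun v v' h => by
      cases v
      cases v'
      simp_all

/-- A memory state: the registers and the contents of the stacks. -/
@[ext] structure Mem where
  v : Reg := {}
  inp : List Γ' := []
  l1 : List Γ' := []
  l2 : List Γ' := []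
  l3 : List Γ' := []
  b2 : List Γ' := []
  b3 : List Γ' := []
  t : List Γ' := []
  u : List Γ' := []
  ub : List Γ' := []
  r : List Γ' := []
  ri : List Γ' := []
  rb : List Γ' := []
  q : List Γ' := []
  x : List Γ' := []
  y : List Γ' := []
  z : List Γ' := []
  a : List Γ' := []
  n : List Γ' := []
  w : List Γ' := []

namespace Mem

/-- The contents of a stack. -/
def get (s : Mem) : Stk → List Γ'
  | .inp => s.inp | .l1 => s.l1 | .l2 => s.l2 | .l3 => s.l3 | .b2 => s.b2 | .b3 => s.b3
  | .t => s.t | .u => s.u | .ub => s.ub | .r => s.r | .ri => s.ri | .rb => s.rb | .q => s.q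
  | .x => s.x | .y => s.y | .z => s.z | .a => s.a | .n => s.n | .w => s.w

/-- Replaces the contents of a stack. -/
def set (s : Mem) : Stk → List Γ' → Mem
  | .inp, l => {s with inp := l} | .l1, l => {s with l1 := l} | .l2, l => {s with l2 := l}
  | .l3, l => {s with l3 := l} | .b2, l => {s with b2 := l} | .b3, l => {s with b3 := l}
  | .t, l => {s with t := l} | .u, l => {s with u := l} | .ub, l => {s with ub := l}
  | .r, l => {s with r := l} | .ri, l => {s with ri := l} | .rb, l => {s with rb := l}
  | .q, l => {s with q := l} | .x, l => {s with x := l} | .y, l => {s with y := l}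
  | .z, l => {s with z := l} | .a, l => {s with a := l} | .n, l => {s with n := l}
  | .w, l => {s with w := l}

/-- Replaces the registers. -/
def setReg (s : Mem) (v : Reg) : Mem := {s with v := v}

theorem ext_get {s s' : Mem} (hv : s.v = s'.v) (h : ∀ k, s.get k = s'.get k) : s = s' := by
  ext1
  exacts [hv, h .inp, h .l1, h .l2, h .l3, h .b2, h .b3, h .t, h .u, h .ub, h .r, h .ri, h .rb,
    h .q, h .x, h .y, h .z, h .a, h .n, h .w]

theorem get_set (s : Mem) (k j : Stk) (l : List Γ') :
    (s.set k l).get j = if j = k then l else s.get j := by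
  cases k <;> cases j <;> rfl

theorem v_set (s : Mem) (k : Stk) (l : List Γ') : (s.set k l).v = s.v := by
  cases k <;> rfl

theorem get_setReg (s : Mem) (v : Reg) (k : Stk) : (s.setReg v).get k = s.get k := by
  cases k <;> rfl

theorem get_set_self (s : Mem) (k : Stk) (l : List Γ') : (s.set k l).get k = l := by
  rw [get_set, if_pos rfl]

end Mem

/-- Elementary operations. A `push` of `none` does nothing. -/
inductive Op
  | push (k : Stk) (g : Reg → Option Γ')
  | pop (k : Stk) (f : Reg → Option Γ' → Reg)
  | load (f : Reg → Reg)

/-- Effect of an elementary operation. -/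
@[simp] def Op.run : Op → Mem → Mem
  | .push k g, s => (g s.v).elim s fun c => s.set k (c :: s.get k)
  | .pop k f, s => (s.set k (s.get k).tail).setReg (f s.v (s.get k).head?)
  | .load f, s => s.setReg (f s.v)

/-- Stores the symbol read by a loop. -/
@[simp] def Reg.setBuf (v : Reg) (c : Option Γ') : Reg := {v with tmp := {v.tmp with buf := c}}

/-- Structured programs. The program `loop k mark p` pops a symbol of the stack `k`, with `none`
standing for the bottom of the stack, and ends if this is `mark`; otherwise it executes `p` and
starts again. -/
inductive Prog
  | ops (l : List Op)
  | seq (p q : Prog)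
  | ite (c : Reg → Bool) (p q : Prog)
  | loop (k : Stk) (mark : Option Γ') (p : Prog)

/-- Sequential composition. -/
infixr:60 " ;; " => Prog.seq

/-- `Runs p s s' t`: started in `s`, the program `p` halts in `s'` after at most `t` steps. -/
inductive Runs : Prog → Mem → Mem → ℕ → Prop
  | ops (l : List Op) (s : Mem) : Runs (.ops l) s (l.foldl (fun s o => o.run s) s) 1
  | seq {p q s s' s'' t t'} : Runs p s s' t → Runs q s' s'' t' → Runs (p ;; q) s s'' (t + t')
  | ite_true {c p q s s' t} : c s.v = true → Runs p s s' t → Runs (.ite c p q) s s' (t + 1)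
  | ite_false {c p q s s' t} : c s.v = false → Runs q s s' t → Runs (.ite c p q) s s' (t + 1)
  | loop_exit {k mark p s} : (s.get k).head? = mark →
      Runs (.loop k mark p) s ((s.set k (s.get k).tail).setReg (s.v.setBuf (s.get k).head?)) 1
  | loop_step {k mark p s s' s'' t t'} : (s.get k).head? ≠ mark →
      Runs p ((s.set k (s.get k).tail).setReg (s.v.setBuf (s.get k).head?)) s' t →
      Runs (.loop k mark p) s' s'' t' → Runs (.loop k mark p) s s'' (t + t' + 1)
  | mono {p s s' t t'} : Runs p s s' t → t ≤ t' → Runs p s s' t'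

/-! ### Compilation to Turing machines -/

section Compilation

open Turing

/-- The alphabets of the stacks; the stack `none` is the output stack. -/
abbrev Alphabet : Option Stk → Type
  | none => Bool
  | some _ => Γ'

/-- The contents of the stacks of the machine while the output is still empty. -/
def Mem.stacks (s : Mem) : ∀ k, List (Alphabet k)
  | none => []
  | some k => s.get k

theorem Mem.update_stacks (s : Mem) (k : Stk) (l : List Γ') :
    Function.update s.stacks (some k) l = (s.set k l).stacks := by
  funext j
  rcases j with _ | j
  · rfl
  · by_cases h : j = k
    · subst h
      simp only [Function.update_self, Mem.stacks, Mem.get_set_self]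
    · rw [Function.update_of_ne (by simpa using h)]
      simp only [Mem.stacks, Mem.get_set, if_neg h]

/-- The statement executing a list of elementary operations and then `q`. -/
def opsStmt {Λ : Type} (q : TM2.Stmt Alphabet Λ Reg) : List Op → TM2.Stmt Alphabet Λ Reg
  | [] => q
  | .push k g :: l => .branch (fun v => (g v).isSome)
      (.push (some k) (fun v => (g v).getD .blank) (opsStmt q l)) (opsStmt q l)
  | .pop k f :: l => .pop (some k) f (opsStmt q l)
  | .load f :: l => .load f (opsStmt q l)

theorem stepAux_opsStmt {Λ : Type} (q : TM2.Stmt Alphabet Λ Reg) (l : List Op) (s : Mem) :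
    TM2.stepAux (opsStmt q l) s.v s.stacks =
      TM2.stepAux q (l.foldl (fun s o => o.run s) s).v (l.foldl (fun s o => o.run s) s).stacks := by
  induction l generalizing s with
  | nil => rfl
  | cons o l ih =>
    rw [List.foldl_cons, ← ih]
    cases o with
    | push k g =>
      cases h : g s.v with
      | none => simp [opsStmt, h]
      | some c =>
        simp only [opsStmt, TM2.stepAux, h, Option.isSome_some, cond_true, Option.getD_some, Op.run,
          Option.elim_some, ← Mem.update_stacks, Mem.v_set]
        rfl
    | pop k f =>
      simp only [opsStmt, TM2.stepAux, Op.run]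
      exact congrArg _ (Mem.update_stacks s k _)
    | load f => rfl

namespace Prog

/-- The labels of the compiled program. -/
def Lab : Prog → Type
  | ops _ => Unit
  | seq p q => p.Lab ⊕ q.Lab
  | ite _ p q => Option (p.Lab ⊕ q.Lab)
  | loop _ _ p => Option p.Lab

/-- There are finitely many labels. -/
@[reducible] def labFintype : (p : Prog) → Fintype p.Lab
  | ops _ => inferInstanceAs (Fintype Unit)
  | seq p q => letI := labFintype p; letI := labFintype q; inferInstanceAs (Fintype (p.Lab ⊕ q.Lab))
  | ite _ p q =>
    letI := labFintype p; letI := labFintype q; inferInstanceAs (Fintype (Option (p.Lab ⊕ q.Lab)))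
  | loop _ _ p => letI := labFintype p; inferInstanceAs (Fintype (Option p.Lab))

/-- The label at which a program starts. -/
def entry : (p : Prog) → p.Lab
  | ops _ => ()
  | seq p _ => Sum.inl p.entry
  | ite _ _ _ => none
  | loop _ _ _ => none

/-- The statements of a program placed in a machine with label type `Λ`: its labels are embedded by
`f`, and control passes to `exit` at the end. -/
def code {Λ : Type} : (p : Prog) → (p.Lab → Λ) → Λ → p.Lab → TM2.Stmt Alphabet Λ Reg
  | ops l, _, exit, _ => opsStmt (.goto fun _ => exit) l
  | seq p q, f, exit, l => match l with
    | .inl l => p.code (f ∘ Sum.inl) (f (.inr q.entry)) l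
    | .inr l => q.code (f ∘ Sum.inr) exit l
  | ite c p q, f, exit, l => match l with
    | none => .branch c (.goto fun _ => f (some (.inl p.entry))) (.goto fun _ => f (some (.inr q.entry)))
    | some (.inl l) => p.code (f ∘ some ∘ Sum.inl) exit l
    | some (.inr l) => q.code (f ∘ some ∘ Sum.inr) exit l
  | loop k mark p, f, exit, l => match l with
    | none => .pop (some k) (fun v c => v.setBuf c)
        (.branch (fun v => v.tmp.buf = mark) (.goto fun _ => exit) (.goto fun _ => f (some p.entry)))
    | some l => p.code (f ∘ some) (f none) l

end Prog

/-- The machine configuration at the label `l` with memory `s`. -/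
def Mem.cfg {Λ : Type} (s : Mem) (l : Λ) : TM2.Cfg Alphabet Λ Reg := ⟨some l, s.v, s.stacks⟩

/-- The machine passes from `c` to `d` in at most `t` steps. -/
def ReachesIn {Λ : Type} (M : Λ → TM2.Stmt Alphabet Λ Reg) (c d : TM2.Cfg Alphabet Λ Reg) (t : ℕ) :
    Prop :=
  ∃ n ≤ t, (flip bind (TM2.step M))^[n] (some c) = some d

theorem ReachesIn.step {Λ : Type} {M : Λ → TM2.Stmt Alphabet Λ Reg} {c d : TM2.Cfg Alphabet Λ Reg}
    (h : TM2.step M c = some d) : ReachesIn M c d 1 :=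
  ⟨1, le_rfl, h⟩

theorem ReachesIn.trans {Λ : Type} {M : Λ → TM2.Stmt Alphabet Λ Reg}
    {c d e : TM2.Cfg Alphabet Λ Reg} {t t' : ℕ} (h : ReachesIn M c d t) (h' : ReachesIn M d e t') :
    ReachesIn M c e (t + t') := by
  obtain ⟨n, hn, h⟩ := h
  obtain ⟨n', hn', h'⟩ := h'
  exact ⟨n' + n, by omega, by rw [Function.iterate_add_apply, h, h']⟩

theorem ReachesIn.mono {Λ : Type} {M : Λ → TM2.Stmt Alphabet Λ Reg}
    {c d : TM2.Cfg Alphabet Λ Reg} {t t' : ℕ} (h : ReachesIn M c d t) (ht : t ≤ t') :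
    ReachesIn M c d t' := by
  obtain ⟨n, hn, h⟩ := h
  exact ⟨n, hn.trans ht, h⟩

/-- The compiled program simulates the structured program, step for step. -/
theorem Runs.reachesIn {Λ : Type} {M : Λ → TM2.Stmt Alphabet Λ Reg} {p : Prog} {s s' : Mem} {t : ℕ}
    (h : Runs p s s' t) (f : p.Lab → Λ) (exit : Λ) (hM : ∀ l, M (f l) = p.code f exit l) :
    ReachesIn M (s.cfg (f p.entry)) (s'.cfg exit) t := by
  induction h generalizing exit with
  | ops l s =>
    refine .step ?_
    rw [Mem.cfg, TM2.step, hM]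
    exact congrArg some (stepAux_opsStmt _ l s)
  | @seq p q s s' s'' t t' _ _ ihp ihq =>
    exact (ihp (f ∘ Sum.inl) (f (.inr q.entry)) fun l => hM (.inl l)).trans
      (ihq (f ∘ Sum.inr) exit fun l => hM (.inr l))
  | @ite_true c p q s s' t hc _ ih =>
    refine ((ReachesIn.step (d := s.cfg (f (some (.inl p.entry)))) ?_).trans
      (ih (f ∘ some ∘ Sum.inl) exit fun l => hM (some (.inl l)))).mono (by omega)
    rw [Mem.cfg, TM2.step, Prog.entry, hM none]
    simp [Prog.code, hc, Mem.cfg]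
  | @ite_false c p q s s' t hc _ ih =>
    refine ((ReachesIn.step (d := s.cfg (f (some (.inr q.entry)))) ?_).trans
      (ih (f ∘ some ∘ Sum.inr) exit fun l => hM (some (.inr l)))).mono (by omega)
    rw [Mem.cfg, TM2.step, Prog.entry, hM none]
    simp [Prog.code, hc, Mem.cfg]
  | @loop_exit k mark p s hs =>
    refine .step ?_
    rw [Mem.cfg, TM2.step, Prog.entry, hM none]
    have hs' : s.stacks (some k) = s.get k := rfl
    simp only [Prog.code, TM2.stepAux, hs', Reg.setBuf, hs, decide_true, cond_true, Mem.cfg,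
      Mem.update_stacks]
    rfl
  | @loop_step k mark p s s' s'' t t' hs _ _ ih ih' =>
    refine ((ReachesIn.step ?_).trans ((ih (f ∘ some) (f none) fun l => hM (some l)).trans
      (ih' f exit hM))).mono (by omega : 1 + (t + t') ≤ _)
    rw [Mem.cfg, TM2.step, Prog.entry, hM none]
    have hs' : s.stacks (some k) = s.get k := rfl
    simp only [Prog.code, TM2.stepAux, hs', Reg.setBuf, hs, decide_false, cond_false, Mem.cfg,
      Mem.update_stacks]
    rfl
  | mono _ ht ih => exact (ih f exit hM).mono ht

/-- The statement for each label of the machine that runs `p`, pushes the register `res` on the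
output stack, resets the registers and halts. -/
def Prog.stmts (p : Prog) : Option p.Lab → TM2.Stmt Alphabet (Option p.Lab) Reg
  | none => .push none (fun v => v.res) (.load (fun _ => {}) .halt)
  | some l => p.code some none l

/-- The machine that runs `p` and outputs the register `res`. -/
noncomputable def Prog.machine (p : Prog) : FinTM2 where
  K := Option Stk
  k₀ := some .inp
  k₁ := none
  Γ := Alphabet
  Λ := Option p.Lab
  main := some p.entry
  ΛFin := letI := p.labFintype; inferInstanceAs (Fintype (Option p.Lab))
  σ := Reg
  initialState := {}
  Γk₀Fin := inferInstanceAs (Fintype Γ')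
  m := p.stmts

/-- A program that decides `f`, leaving all stacks empty, within polynomial time. -/
theorem Prog.computableInPolyTime {α β : Type} (p : Prog) (enc : α → List Γ') (dec : β → List Bool)
    (f : α → β) (time : Polynomial ℕ)
    (h : ∀ a, ∃ v : Reg, dec (f a) = [v.res] ∧
      Runs p { inp := enc a } { v := v } (time.eval (enc a).length)) :
    Nonempty (TM2ComputableInPolyTime enc dec f) := by
  refine ⟨{ tm := p.machine, inputAlphabet := Equiv.refl _, outputAlphabet := Equiv.refl _
            time := time + 1, outputsFun := fun a => ?_ }⟩
  have key : ∃ n ≤ (time + 1).eval (enc a).length,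
      (flip bind p.machine.step)^[n] (some (initList p.machine (enc a))) =
        some (haltList p.machine (dec (f a))) := by
    obtain ⟨v, hv, hr⟩ := h a
    have h1 := hr.reachesIn (M := p.stmts) some none fun l => rfl
    have h2 : ReachesIn p.stmts (Mem.cfg { v := v } none) (haltList p.machine (dec (f a))) 1 := by
      refine .step ?_
      rw [Mem.cfg, TM2.step, Prog.stmts, hv]
      simp only [TM2.stepAux]
      unfold haltList
      refine congrArg some (congrArg (TM2.Cfg.mk none ({} : Reg)) ?_)
      funext k
      rcases k with _ | k
      · rfl
      · cases k <;> rfl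
    have h3 : initList p.machine (enc a) = Mem.cfg { inp := enc a } (some p.entry) := by
      unfold initList Mem.cfg
      congr 1
      funext k
      rcases k with _ | k
      · rfl
      · cases k <;> rfl
    rw [h3, Polynomial.eval_add, Polynomial.eval_one]
    exact h1.trans h2
  have hid : ∀ {δ : Type} (l : List δ), l.map (Equiv.refl δ).invFun = l := fun l => List.map_id l
  refine ⟨⟨key.choose, ?_⟩, key.choose_spec.1⟩
  refine Eq.trans ?_ (key.choose_spec.2.trans ?_)
  · exact congrArg (fun l => (flip bind p.machine.step)^[key.choose] (some (initList p.machine l)))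
      (hid (enc a))
  · exact congrArg (fun l => some (haltList p.machine l)) (hid (dec (f a))).symm

end Compilation

/-! ### Binary arithmetic -/

/-- The number with the given binary digits, least significant digit first. -/
def val : List Bool → ℕ
  | [] => 0
  | b :: l => b.toNat + 2 * val l

theorem val_encodeNat (n : ℕ) : val (encodeNat n) = n := by
  have h : ∀ p : PosNum, val (encodePosNum p) = p := by
    intro p
    induction p with
    | one => rfl
    | bit0 p ih => simp [encodePosNum, val, ih, PosNum.cast_bit0, two_mul]
    | bit1 p ih => simp [encodePosNum, val, ih, PosNum.cast_bit1]; omega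
  have h' : ∀ m : Num, val (encodeNum m) = m := by
    rintro (_ | p)
    · rfl
    · exact h p
  rw [encodeNat, h', Num.to_of_nat]

theorem bodd_val (l : List Bool) : (val l).bodd = l.headD false := by
  cases l with
  | nil => rfl
  | cons b l => cases b <;> simp [val, Nat.bodd_add, Nat.bodd_mul]

theorem val_eq_zero_iff (l : List Bool) : val l = 0 ↔ true ∉ l := by
  induction l with
  | nil => simp [val]
  | cons b l ih => cases b <;> simp [val, ih]

/-- The borrow of one step of a subtraction. -/
def borrow (x y b : Bool) : Bool := (!x && (y || b)) || (y && b)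

/-- Digitwise subtraction `x - y - b`: the digits at the places of `x`, and the last borrow. -/
def subDigits : List Bool → List Bool → Bool → List Bool × Bool
  | [], _, b => ([], b)
  | x :: xs, ys, b =>
    let r := subDigits xs ys.tail (borrow x (ys.headD false) b)
    ((x ^^ ys.headD false ^^ b) :: r.1, r.2)

theorem length_subDigits (x y : List Bool) (b : Bool) : (subDigits x y b).1.length = x.length := by
  induction x generalizing y b with
  | nil => rfl
  | cons c x ih => simp [subDigits, ih]

theorem val_subDigits (x y : List Bool) (b : Bool) :
    val x + 2 ^ x.length * ((subDigits x y b).2.toNat + val (y.drop x.length)) =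
      val y + b.toNat + val (subDigits x y b).1 := by
  induction x generalizing y b with
  | nil => simp [subDigits, val]; omega
  | cons c x ih =>
    have h := ih y.tail (borrow c (y.headD false) b)
    have hy : val y = (y.headD false).toNat + 2 * val y.tail := by cases y <;> simp [val]
    have hd : y.drop (c :: x).length = y.tail.drop x.length := by cases y <;> simp
    have h2 : ∀ m, 2 ^ (c :: x).length * m = 2 * (2 ^ x.length * m) := fun m => by
      rw [List.length_cons, pow_succ]; ring
    rw [hd, hy, h2]
    simp only [subDigits, val]
    have hb : c.toNat + 2 * (borrow c (y.headD false) b).toNat =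
        (y.headD false).toNat + b.toNat + (c ^^ y.headD false ^^ b).toNat := by
      cases c <;> cases y.headD false <;> cases b <;> rfl
    omega

/-- Truncated subtraction of binary numbers. -/
def monus (x y : List Bool) : List Bool :=
  if (subDigits x y false).2 || (y.drop x.length).any id then [] else (subDigits x y false).1

theorem val_lt_two_pow (x : List Bool) : val x < 2 ^ x.length := by
  induction x with
  | nil => simp [val]
  | cons b x ih => cases b <;> simp [val, pow_succ] <;> omega

theorem val_monus (x y : List Bool) : val (monus x y) = val x - val y := by
  have h := val_subDigits x y false
  have hx := val_lt_two_pow x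
  have hz := val_eq_zero_iff (y.drop x.length)
  have hd := val_lt_two_pow (subDigits x y false).1
  rw [length_subDigits] at hd
  unfold monus
  have hany : (y.drop x.length).any id = true ↔ true ∈ y.drop x.length := by simp
  by_cases hc : ((subDigits x y false).2 || (y.drop x.length).any id) = true
  · rw [if_pos hc]
    have : 0 < (subDigits x y false).2.toNat + val (y.drop x.length) := by
      rw [Bool.or_eq_true] at hc
      rcases hc with hc | hc
      · simp [hc]
      · have := hany.1 hc
        have : val (y.drop x.length) ≠ 0 := fun h0 => hz.1 h0 this
        omega
    have := Nat.mul_le_mul_left (2 ^ x.length) this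
    simp only [val]
    simp only [Bool.toNat_false] at h
    omega
  · rw [if_neg hc]
    have h1 : (subDigits x y false).2 = false := by
      cases hh : (subDigits x y false).2 <;> simp_all
    have h2 : val (y.drop x.length) = 0 := hz.2 fun hm => hc (by simp [hany.2 hm])
    rw [h1, h2] at h
    simp at h
    omega

theorem length_monus_le (x y : List Bool) : (monus x y).length ≤ x.length := by
  unfold monus
  split_ifs
  · simp
  · exact (length_subDigits x y false).le

/-! ### Running programs up to temporary registers -/

/-- Replaces the temporary registers. -/
def Mem.withTmp (s : Mem) (tm : Tmp) : Mem := {s with v := {s.v with tmp := tm}}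

/-- `p` leads from `s` to `s'` in at most `t` steps, whatever the temporary registers contain at
the start, and up to the contents of these registers at the end. -/
def Does (p : Prog) (s s' : Mem) (t : ℕ) : Prop :=
  ∀ tm, ∃ tm', Runs p (s.withTmp tm) (s'.withTmp tm') t

theorem Mem.get_withTmp (s : Mem) (tm : Tmp) (k : Stk) : (s.withTmp tm).get k = s.get k := by
  cases k <;> rfl

theorem Mem.set_withTmp (s : Mem) (tm : Tmp) (k : Stk) (l : List Γ') :
    (s.withTmp tm).set k l = (s.set k l).withTmp tm := by
  cases k <;> rfl

theorem Runs.congr_mem {p : Prog} {s s' s'' : Mem} {t : ℕ} (h : Runs p s s' t) (hs : s' = s'') :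
    Runs p s s'' t := hs ▸ h

namespace Does

variable {p q : Prog} {s s' s'' : Mem} {t t' : ℕ}

theorem mono (h : Does p s s' t) (ht : t ≤ t') : Does p s s' t' := fun tm =>
  let ⟨tm', h'⟩ := h tm
  ⟨tm', h'.mono ht⟩

theorem congr (h : Does p s s' t) (hs : s' = s'') : Does p s s'' t := hs ▸ h

theorem seq (h : Does p s s' t) (h' : Does q s' s'' t') : Does (p ;; q) s s'' (t + t') := fun tm =>
  let ⟨tm', h1⟩ := h tm
  let ⟨tm'', h2⟩ := h' tm'
  ⟨tm'', h1.seq h2⟩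

theorem ops {l : List Op}
    (h : ∀ tm, (l.foldl (fun s o => o.run s) (s.withTmp tm)).withTmp {} = s'.withTmp {}) :
    Does (.ops l) s s' 1 := fun tm => by
  have h1 := Runs.ops l (s.withTmp tm)
  have h2 := h tm
  generalize l.foldl (fun s o => o.run s) (s.withTmp tm) = s1 at h1 h2
  refine ⟨s1.v.tmp, ?_⟩
  have : s1 = (s1.withTmp {}).withTmp s1.v.tmp := rfl
  rw [this, h2] at h1
  exact h1

theorem ite_true {c : Reg → Bool} (hc : ∀ tm, c (s.withTmp tm).v = true) (h : Does p s s' t) :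
    Does (.ite c p q) s s' (t + 1) := fun tm =>
  let ⟨tm', h'⟩ := h tm
  ⟨tm', .ite_true (hc tm) h'⟩

theorem ite_false {c : Reg → Bool} (hc : ∀ tm, c (s.withTmp tm).v = false) (h : Does q s s' t) :
    Does (.ite c p q) s s' (t + 1) := fun tm =>
  let ⟨tm', h'⟩ := h tm
  ⟨tm', .ite_false (hc tm) h'⟩

theorem loop_nil {k : Stk} (hk : s.get k = []) : Does (.loop k none p) s s 1 := fun tm => by
  have h := Runs.loop_exit (p := p) (mark := none) (k := k) (s := s.withTmp tm)
    (by rw [Mem.get_withTmp, hk]; rfl)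
  refine ⟨{tm with buf := none}, ?_⟩
  refine h.congr_mem ?_
  rw [Mem.get_withTmp, hk]
  refine Mem.ext_get (by simp [Mem.setReg, Mem.withTmp]) fun j => ?_
  rw [Mem.get_withTmp, Mem.get_setReg, Mem.get_set, Mem.get_withTmp]
  split_ifs with hj
  · rw [hj, hk]; rfl
  · rfl

theorem loop_cons {k : Stk} {c : Γ'} {l : List Γ'} (hk : s.get k = c :: l)
    (h : Does p (s.set k l) s' t) (h' : Does (.loop k none p) s' s'' t') :
    Does (.loop k none p) s s'' (t + t' + 1) := fun tm => by
  obtain ⟨tm1, h1⟩ := h {tm with buf := some c}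
  obtain ⟨tm2, h2⟩ := h' tm1
  refine ⟨tm2, .loop_step (by simp [Mem.get_withTmp, hk]) ?_ h2⟩
  convert h1 using 1
  rw [Mem.get_withTmp, hk, Mem.set_withTmp]
  cases k <;> rfl

end Does

/-! ### Copying -/

/-- Pushes the elements of `l` on each of the stacks in `ds`, the first element first. -/
def Mem.pushAll (s : Mem) (ds : List Stk) (l : List Γ') : Mem :=
  ds.foldl (fun s d => s.set d (l.reverse ++ s.get d)) s

theorem Mem.get_pushAll (s : Mem) (ds : List Stk) (hds : ds.Nodup) (l : List Γ') (j : Stk) :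
    (s.pushAll ds l).get j = if j ∈ ds then l.reverse ++ s.get j else s.get j := by
  induction ds generalizing s with
  | nil => rfl
  | cons d ds ih =>
    rw [List.nodup_cons] at hds
    have h : (s.pushAll (d :: ds) l) = (s.set d (l.reverse ++ s.get d)).pushAll ds l := rfl
    rw [h, ih _ hds.2, Mem.get_set]
    by_cases hj : j = d
    · subst hj
      simp [hds.1]
    · simp [hj]

theorem Mem.v_pushAll (s : Mem) (ds : List Stk) (l : List Γ') : (s.pushAll ds l).v = s.v := by
  induction ds generalizing s with
  | nil => rfl
  | cons d ds ih => exact (ih _).trans (Mem.v_set _ _ _)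

theorem foldl_push (ds : List Stk) (g : Reg → Option Γ') (c : Γ') (s : Mem) (h : g s.v = some c) :
    (ds.map fun d => Op.push d g).foldl (fun s o => o.run s) s = s.pushAll ds [c] := by
  induction ds generalizing s with
  | nil => rfl
  | cons d ds ih =>
    rw [List.map_cons, List.foldl_cons, Op.run, h, Option.elim_some,
      ih _ (by rw [Mem.v_set, h])]
    rfl

/-- Moves the symbols of `k` above `mark` to each of the stacks in `ds`, in reverse order. The
symbol `mark` itself is deleted. -/
def copy (k : Stk) (mark : Option Γ') (ds : List Stk) : Prog :=
  .loop k mark (.ops (ds.map fun d => .push d fun v => v.tmp.buf))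

theorem copy_runs {k : Stk} {mark : Option Γ'} {ds : List Stk} (hk : k ∉ ds) (hds : ds.Nodup)
    {l rest : List Γ'} {s : Mem} (hs : s.get k = l ++ rest) (hrest : rest.head? = mark)
    (hl : ∀ c ∈ l, some c ≠ mark) :
    Runs (copy k mark ds) s (((s.set k rest.tail).pushAll ds l).setReg (s.v.setBuf mark))
      (2 * l.length + 1) := by
  induction l generalizing s with
  | nil =>
    have := Runs.loop_exit (k := k) (mark := mark) (s := s)
      (p := .ops (ds.map fun d => .push d fun v => v.tmp.buf)) (by rw [hs]; exact hrest)
    rw [hs, List.nil_append, hrest] at this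
    refine this.congr_mem (Mem.ext_get rfl fun j => ?_)
    rw [Mem.get_setReg, Mem.get_setReg, Mem.get_pushAll _ _ hds]
    simp
  | cons c l ih =>
    have hb := Runs.ops (ds.map fun d => .push d fun v => v.tmp.buf)
      ((s.set k (s.get k).tail).setReg (s.v.setBuf (s.get k).head?))
    rw [foldl_push ds _ c _ (by simp [hs, Mem.setReg])] at hb
    have hget : ∀ j, (((s.set k (s.get k).tail).setReg (s.v.setBuf (s.get k).head?)).pushAll
        ds [c]).get j = if j = k then l ++ rest else if j ∈ ds then c :: s.get j else s.get j := by
      intro j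
      rw [Mem.get_pushAll _ _ hds, Mem.get_setReg, Mem.get_set, hs]
      by_cases hj : j = k
      · subst hj
        simp [hk]
      · simp [hj]
    have hv : (((s.set k (s.get k).tail).setReg (s.v.setBuf (s.get k).head?)).pushAll
        ds [c]).v = s.v.setBuf (some c) := by
      rw [Mem.v_pushAll, hs]
      rfl
    generalize ((s.set k (s.get k).tail).setReg (s.v.setBuf (s.get k).head?)).pushAll ds [c] = s1
      at hb hget hv
    have h1 := ih (s := s1) (by rw [hget, if_pos rfl]) fun c hc => hl c (by simp [hc])
    refine .mono (.loop_step (by rw [hs]; exact hl c (by simp)) hb ?_) (t := 1 + (2 * l.length + 1) + 1)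
      (by simp; omega)
    refine h1.congr_mem (Mem.ext_get (by simp [Mem.setReg, hv]) fun j => ?_)
    rw [Mem.get_setReg, Mem.get_setReg, Mem.get_pushAll _ _ hds, Mem.get_pushAll _ _ hds,
      Mem.get_set, Mem.get_set, hget]
    by_cases hj : j = k
    · subst hj
      simp [hk]
    · by_cases hd : j ∈ ds <;> simp [hj, hd]

theorem Mem.pushAll_withTmp (s : Mem) (ds : List Stk) (l : List Γ') (tm : Tmp) :
    (s.withTmp tm).pushAll ds l = (s.pushAll ds l).withTmp tm := by
  induction ds generalizing s with
  | nil => rfl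
  | cons d ds ih =>
    simp only [Mem.pushAll, List.foldl_cons] at ih ⊢
    rw [Mem.get_withTmp, Mem.set_withTmp, ih]

namespace Does

theorem copy {k : Stk} {mark : Option Γ'} {ds : List Stk} {s : Mem} {l rest : List Γ'}
    (hs : s.get k = l ++ rest) (hrest : rest.head? = mark) (hl : ∀ c ∈ l, some c ≠ mark)
    (hk : k ∉ ds := by decide) (hds : ds.Nodup := by decide) :
    Does (copy k mark ds) s ((s.set k rest.tail).pushAll ds l) (2 * l.length + 1) := fun tm => by
  have h := copy_runs (s := s.withTmp tm) hk hds (by rw [Mem.get_withTmp, hs]) hrest hl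
  refine ⟨{tm with buf := mark}, ?_⟩
  refine h.congr_mem ?_
  rw [Mem.set_withTmp, Mem.pushAll_withTmp]
  refine Mem.ext_get ?_ fun j => by
    rw [Mem.get_withTmp, Mem.get_setReg, Mem.get_withTmp]
  simp only [Mem.withTmp, Mem.v_pushAll, Mem.v_set]
  rfl

/-- Emptying a stack. -/
theorem copy_all {k : Stk} {ds : List Stk} {s : Mem} {l : List Γ'} (hs : s.get k = l)
    (hk : k ∉ ds := by decide) (hds : ds.Nodup := by decide) :
    Does (WAK.copy k none ds) s ((s.set k []).pushAll ds l) (2 * l.length + 1) :=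
  Does.copy (rest := []) (by simpa using hs) rfl (by simp) hk hds

theorem copy_until {k : Stk} {ds : List Stk} {s : Mem} {l rest : List Γ'} {c : Γ'}
    (hs : s.get k = l ++ c :: rest) (hc : c ∉ l)
    (hk : k ∉ ds := by decide) (hds : ds.Nodup := by decide) :
    Does (WAK.copy k (some c) ds) s ((s.set k rest).pushAll ds l) (2 * l.length + 1) :=
  Does.copy hs rfl (fun d hd h => hc (by simpa using Option.some.inj h ▸ hd)) hk hds

end Does

/-! ### Arithmetic on the stacks -/

/-- The symbols of a list of digits. -/
abbrev bits (l : List Bool) : List Γ' := l.map Γ'.bit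

/-- Whether a symbol is the digit `1`. -/
def isOne : Option Γ' → Bool
  | some (.bit b) => b
  | _ => false

theorem isOne_head?_bits (l : List Bool) : isOne (bits l).head? = l.headD false := by
  cases l <;> rfl

theorem isOne_bit (b : Bool) : isOne (some (.bit b)) = b := rfl

/-- One step of a subtraction: `buf` holds a digit of the minuend, the digits of the subtrahend are
read from `src`, and the digits of the difference are pushed on the scratch stack `n`. -/
def subtractDigit (src : Stk) : List Op := [
  .pop src fun v c => {v with tmp := {v.tmp with c2 := c}},
  .push .n fun v => some (.bit (isOne v.tmp.buf ^^ isOne v.tmp.c2 ^^ v.tmp.bor)),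
  .load fun v => {v with tmp :=
    {v.tmp with bor := borrow (isOne v.tmp.buf) (isOne v.tmp.c2) v.tmp.bor}}]

/-- Raises the borrow if `buf` holds the digit `1`. -/
def updateBorrow : List Op :=
  [.load fun v => {v with tmp := {v.tmp with bor := v.tmp.bor || isOne v.tmp.buf}}]

/-- Subtracts the number on the stack `src` from the number on the stack `k`; empties `src`. -/
def subtract (k src : Stk) : Prog :=
  .ops [.load fun v => {v with tmp := {v.tmp with bor := false}}] ;;
  .loop k none (.ops (subtractDigit src)) ;;
  .loop src none (.ops updateBorrow) ;;
  .ite (fun v => v.tmp.bor) (copy .n none []) (copy .n none [k])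

theorem subtract_digits_runs {k src : Stk} (h1 : k ≠ src) (h2 : k ≠ .n) (h3 : src ≠ .n)
    (x y : List Bool) (s : Mem) (hx : s.get k = bits x) (hy : s.get src = bits y) :
    ∃ s', Runs (.loop k none (.ops (subtractDigit src)))
      s s' (2 * x.length + 1) ∧ (s'.withTmp {}).v = (s.withTmp {}).v ∧
      s'.v.tmp.bor = (subDigits x y s.v.tmp.bor).2 ∧
      ∀ j, s'.get j = if j = k then [] else if j = src then bits (y.drop x.length) else
        if j = .n then (bits (subDigits x y s.v.tmp.bor).1).reverse ++ s.get .n else s.get j := by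
  induction x generalizing y s with
  | nil =>
    refine ⟨_, .loop_exit (by simp [hx]), rfl, rfl, fun j => ?_⟩
    rw [Mem.get_setReg, Mem.get_set, hx]
    split_ifs with ha hb hc
    · rfl
    · simp [hb, hy]
    · simp [hc, subDigits]
    · rfl
  | cons c x ih =>
    obtain ⟨s1, hs1⟩ : ∃ s1, s1 = (subtractDigit src).foldl (fun s o => o.run s)
      ((s.set k (bits x)).setReg (s.v.setBuf (some (.bit c)))) := ⟨_, rfl⟩
    have hstep : Runs (.ops (subtractDigit src))
        ((s.set k (bits x)).setReg (s.v.setBuf (some (.bit c)))) s1 1 := hs1 ▸ Runs.ops _ _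
    have hv : ∀ (s : Mem) v, (s.setReg v).v = v := fun _ _ => rfl
    simp only [subtractDigit, List.foldl_cons, List.foldl_nil, Op.run, Option.elim_some, hv,
      Mem.get_setReg, Mem.v_set, Mem.get_set, if_neg h1.symm, if_neg h2.symm, if_neg h3.symm, hy,
      isOne_head?_bits, Reg.setBuf, isOne_bit] at hs1
    have hget : ∀ j, s1.get j = if j = k then bits x else if j = src then bits y.tail else
        if j = .n then .bit (c ^^ y.headD false ^^ s.v.tmp.bor) :: s.get .n else s.get j := by
      intro j
      subst hs1
      simp only [Mem.get_setReg, Mem.get_set]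
      by_cases ha : j = k
      · simp [ha, h1, h2]
      by_cases hb : j = src
      · simp [hb, h1.symm, h3]
      · by_cases hc : j = .n <;> simp [ha, hb, hc, h2.symm, h3.symm]
    have hbor : s1.v.tmp.bor = borrow c (y.headD false) s.v.tmp.bor := by
      subst hs1
      rfl
    have hvv : (s1.withTmp {}).v = (s.withTmp {}).v := by
      subst hs1
      rfl
    obtain ⟨s', hr, hv', hb', hg'⟩ := ih y.tail s1 (by rw [hget, if_pos rfl])
      (by rw [hget, if_neg h1.symm, if_pos rfl])
    refine ⟨s', .mono (.loop_step (by simp [hx]) (by rw [hx]; exact hstep) hr) ?_, hv'.trans hvv, ?_,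
      fun j => ?_⟩
    · simp
      omega
    · rw [hb', hbor]
      rfl
    · rw [hg', hget .n, hget j, if_neg h2.symm, if_neg h3.symm, if_pos rfl, hbor]
      have hd : y.drop (c :: x).length = y.tail.drop x.length := by cases y <;> simp
      rw [hd]
      by_cases ha : j = k
      · simp [ha]
      by_cases hb : j = src
      · simp [hb, h1.symm]
      · by_cases hc : j = .n <;> simp [ha, hb, hc, subDigits]

theorem subtract_rest_runs {src : Stk} (y : List Bool) (s : Mem) (hy : s.get src = bits y) :
    ∃ tm : Tmp, Runs (.loop src none (.ops updateBorrow))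
      s ((s.set src []).withTmp tm) (2 * y.length + 1) ∧ tm.bor = (s.v.tmp.bor || y.any id) := by
  induction y generalizing s with
  | nil =>
    refine ⟨{s.v.tmp with buf := none}, (Runs.loop_exit (by simp [hy])).congr_mem ?_, by simp⟩
    rw [hy, ← Mem.set_withTmp]
    cases src <;> rfl
  | cons c y ih =>
    obtain ⟨tm, h1, h2⟩ := ih ((s.set src (bits y)).withTmp
      {s.v.tmp with buf := some (.bit c), bor := s.v.tmp.bor || c})
      (by rw [Mem.get_withTmp, Mem.get_set_self])
    have h0 : Runs (.ops updateBorrow) ((s.set src (bits y)).setReg (s.v.setBuf (some (.bit c))))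
        ((s.set src (bits y)).withTmp
          {s.v.tmp with buf := some (.bit c), bor := s.v.tmp.bor || c}) 1 :=
      (Runs.ops _ _).congr_mem (by cases src <;> rfl)
    have h3 := h1.congr_mem (s'' := (s.set src []).withTmp tm) (by cases src <;> rfl)
    refine ⟨tm, .mono (.loop_step (by simp [hy]) (by rw [hy]; exact h0) h3) ?_, ?_⟩
    · simp
      omega
    · rw [h2]
      simp [Mem.withTmp, Bool.or_assoc]

theorem subtract_does {k src : Stk} {x y : List Bool} {s : Mem} (hx : s.get k = bits x)
    (hy : s.get src = bits y) (hn : s.get .n = []) (h1 : k ≠ src := by decide)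
    (h2 : k ≠ .n := by decide) (h3 : src ≠ .n := by decide) :
    Does (subtract k src) s ((s.set src []).set k (bits (monus x y)))
      (4 * x.length + 2 * y.length + 5) := fun tm => by
  obtain ⟨s1, hr1, hv1, hb1, hg1⟩ := subtract_digits_runs h1 h2 h3 x y
    (s.withTmp {tm with bor := false}) (by rw [Mem.get_withTmp, hx]) (by rw [Mem.get_withTmp, hy])
  obtain ⟨tm2, hr2, hb2⟩ := subtract_rest_runs (src := src) (y.drop x.length) s1
    (by rw [hg1, if_neg h1.symm, if_pos rfl])
  have hr0 : Runs (.ops [.load fun v => {v with tmp := {v.tmp with bor := false}}])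
    (s.withTmp tm) (s.withTmp {tm with bor := false}) 1 := Runs.ops _ _
  have hv2 : ∀ tm, ((s1.set src []).withTmp tm).v = (s.withTmp tm).v := fun tm => by
    have : ∀ s : Mem, ∀ tm, (s.withTmp tm).v = {(s.withTmp {}).v with tmp := tm} := fun _ _ => rfl
    have h0 : ((s1.set src []).withTmp {}).v = (s1.withTmp {}).v := by
      simp only [Mem.withTmp, Mem.v_set]
    rw [this, h0, hv1]
    rfl
  have hg2 : ∀ j tm, ((s1.set src []).withTmp tm).get j = if j = k then [] else if j = src then []
      else if j = .n then (bits (subDigits x y false).1).reverse else s.get j := by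
    intro j tm
    rw [Mem.get_withTmp, Mem.get_set, hg1, Mem.get_withTmp, Mem.get_withTmp, hn, List.append_nil]
    by_cases ha : j = k
    · simp [ha]
    · by_cases hb : j = src <;> simp [ha, hb, Mem.withTmp]
  have hlen : (y.drop x.length).length ≤ y.length := by simp
  have hbor : tm2.bor = ((subDigits x y false).2 || (y.drop x.length).any id) := by
    rw [hb2, hb1]
    rfl
  have hnn : ((s1.set src []).withTmp tm2).get .n = (bits (subDigits x y false).1).reverse := by
    rw [hg2, if_neg h2.symm, if_neg h3.symm, if_pos rfl]
  have hl : (bits (subDigits x y false).1).reverse.length = x.length := by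
    simp [length_subDigits]
  have hR : ∀ j tm, (((s.set src []).set k (bits (monus x y))).withTmp tm).get j =
      if j = k then bits (monus x y) else if j = src then [] else s.get j := fun j tm => by
    rw [Mem.get_withTmp, Mem.get_set, Mem.get_set]
  cases hc : tm2.bor
  · have hm : monus x y = (subDigits x y false).1 := by
      rw [monus, ← hbor, hc]
      rfl
    have hcp := copy_runs (k := .n) (mark := none) (ds := [k]) (by simpa using h2.symm) (by simp)
      (rest := []) (by rw [hnn, List.append_nil]) rfl (by simp)
    refine ⟨{tm2 with buf := none}, Runs.mono (t := 1 + ((2 * x.length + 1) +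
      ((2 * (y.drop x.length).length + 1) + ((2 * x.length + 1) + 1)))) (hr0.seq (hr1.seq (hr2.seq
      (.ite_false hc (hl ▸ hcp.congr_mem (Mem.ext_get ?_ fun j => ?_)))))) (by omega)⟩
    · have := hv2 {tm2 with buf := none}
      simp only [Mem.withTmp, Mem.v_set] at this ⊢
      exact this
    · rw [hR, Mem.get_setReg, Mem.get_pushAll _ _ (by simp), Mem.get_set, hg2, hm]
      by_cases ha : j = k
      · subst ha
        simp [h2]
      by_cases hb : j = src
      · subst hb
        simp [ha, h3]
      · by_cases hd : j = .n
        · simp [hd, h2.symm, h3.symm, hn]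
        · simp [ha, hb, hd]
  · have hm : monus x y = [] := by
      rw [monus, ← hbor, hc]
      rfl
    have hcp := copy_runs (k := .n) (mark := none) (ds := []) (by simp) (by simp)
      (rest := []) (by rw [hnn, List.append_nil]) rfl (by simp)
    refine ⟨{tm2 with buf := none}, Runs.mono (t := 1 + ((2 * x.length + 1) +
      ((2 * (y.drop x.length).length + 1) + ((2 * x.length + 1) + 1)))) (hr0.seq (hr1.seq (hr2.seq
      (.ite_true hc (hl ▸ hcp.congr_mem (Mem.ext_get ?_ fun j => ?_)))))) (by omega)⟩
    · have := hv2 {tm2 with buf := none}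
      simp only [Mem.withTmp, Mem.v_set] at this ⊢
      exact this
    · rw [hR, Mem.get_setReg, Mem.get_pushAll _ _ (by simp), Mem.get_set, hg2, hm]
      by_cases ha : j = k
      · subst ha
        simp [h2]
      by_cases hb : j = src
      · subst hb
        simp [ha, h3]
      · by_cases hd : j = .n
        · simp [hd, h2.symm, h3.symm, hn]
        · simp [ha, hb, hd]

/-! ### Reading numbers and rows -/

namespace Does

theorem loop_cons_buf {p : Prog} {s s' s'' : Mem} {t t' : ℕ} {k : Stk} {c : Γ'} {l : List Γ'}
    (hk : s.get k = c :: l)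
    (h : ∀ tm, tm.buf = some c → ∃ tm', Runs p ((s.set k l).withTmp tm) (s'.withTmp tm') t)
    (h' : Does (.loop k none p) s' s'' t') : Does (.loop k none p) s s'' (t + t' + 1) := fun tm => by
  obtain ⟨tm1, h1⟩ := h {tm with buf := some c} rfl
  obtain ⟨tm2, h2⟩ := h' tm1
  refine ⟨tm2, .loop_step (by simp [Mem.get_withTmp, hk]) ?_ h2⟩
  convert h1 using 1
  rw [Mem.get_withTmp, hk, Mem.set_withTmp]
  cases k <;> rfl

end Does

/-- Sets the register `nz` to tell whether the number on the stack `k` is nonzero. -/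
def testNonzero (k : Stk) : Prog :=
  .ops [.load fun v => {v with nz := false}] ;;
  .loop k none (.ops [.push .n fun v => v.tmp.buf,
    .load fun v => {v with nz := v.nz || isOne v.tmp.buf}]) ;;
  copy .n none [k]

theorem testNonzero_loop_does {k : Stk} (hk : k ≠ .n) (x : List Bool) (s : Mem)
    (hx : s.get k = bits x) :
    Does (.loop k none (.ops [.push .n fun v => v.tmp.buf,
      .load fun v => {v with nz := v.nz || isOne v.tmp.buf}])) s
      (((s.set k []).set .n ((bits x).reverse ++ s.get .n)).setReg
        {s.v with nz := s.v.nz || x.any id}) (2 * x.length + 1) := by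
  induction x generalizing s with
  | nil =>
    refine (Does.loop_nil hx).congr (Mem.ext_get (by simp [Mem.setReg]) fun j => ?_)
    rw [Mem.get_setReg, Mem.get_set, Mem.get_set]
    by_cases hj : j = .n
    · simp [hj]
    · by_cases hj' : j = k <;> simp_all
  | cons c x ih =>
    have h1 := ih (((s.set k (bits x)).set .n (.bit c :: s.get .n)).setReg
      {s.v with nz := s.v.nz || c}) (by simp [Mem.get_setReg, Mem.get_set, hk])
    refine ((Does.loop_cons_buf (t := 1) hx (fun tm htm => ⟨tm, (Runs.ops _ _).congr_mem ?_⟩)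
      h1).mono (by simp; omega)).congr ?_
    · have hv : ((s.set k (bits x)).withTmp tm).v.tmp.buf = some (.bit c) := htm
      simp only [List.foldl_cons, List.foldl_nil, Op.run]
      simp only [Mem.get_withTmp, Mem.get_set, if_neg hk.symm]
      cases k <;> first | exact absurd rfl hk | (simp [Mem.withTmp, Mem.set, htm, Mem.setReg, isOne_bit])
    · refine Mem.ext_get (by simp [Mem.setReg, Bool.or_assoc]) fun j => ?_
      simp only [Mem.get_setReg, Mem.get_set]
      by_cases hj : j = .n
      · simp [hj]
      · by_cases hj' : j = k <;> simp [hj, hj']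

theorem any_eq_decide_val (x : List Bool) : x.any id = decide (val x ≠ 0) := by
  have h := val_eq_zero_iff x
  by_cases hx : true ∈ x
  · have h1 : x.any id = true := List.any_eq_true.2 ⟨true, hx, rfl⟩
    rw [h1, eq_comm, decide_eq_true_iff]
    exact fun h0 => h.1 h0 hx
  · have h1 : x.any id = false := by
      rw [List.any_eq_false]
      rintro b hb hb'
      exact hx (by simpa using hb' ▸ hb)
    rw [h1, eq_comm, decide_eq_false_iff_not, not_not]
    exact h.2 hx

theorem testNonzero_does {k : Stk} {x : List Bool} {s : Mem} (hx : s.get k = bits x)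
    (hn : s.get .n = []) (hk : k ≠ .n := by decide) :
    Does (testNonzero k) s (s.setReg {s.v with nz := decide (val x ≠ 0)}) (4 * x.length + 3) := by
  have h1 : Does (.ops [.load fun v => {v with nz := false}]) s (s.setReg {s.v with nz := false}) 1 :=
    .ops fun tm => rfl
  have h2 := testNonzero_loop_does hk x (s.setReg {s.v with nz := false})
    (by rw [Mem.get_setReg, hx])
  have h3 := Does.copy_all (k := .n) (ds := [k]) (l := (bits x).reverse)
    (s := (((s.setReg {s.v with nz := false}).set k []).set .n ((bits x).reverse ++
      (s.setReg {s.v with nz := false}).get .n)).setReg {s.v with nz := false || x.any id})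
    (by simp [Mem.get_setReg, Mem.get_set, hn]) (by simpa using hk.symm) (by simp)
  refine ((h1.seq (h2.seq h3)).mono ?_).congr (Mem.ext_get ?_ fun j => ?_)
  · simp
    omega
  · rw [Mem.v_pushAll, Mem.v_set, ← any_eq_decide_val]
    rfl
  · simp only [Mem.get_pushAll _ _ (List.nodup_singleton k), Mem.get_setReg, Mem.get_set, hn]
    by_cases hj : j = .n
    · simp [hj, hk.symm, hn]
    · by_cases hj' : j = k <;> simp [hj, hj', hk, hx]

/-- Moves the symbols of `src` above `mark` to each of the stacks in `ds`, in the same order. A copy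
of everything that is read is kept, in reverse order, on the stacks in `bk`. -/
def fetch (src : Stk) (mark : Γ') (bk ds : List Stk) : Prog :=
  copy src (some mark) (bk ++ [.t]) ;; .ops (bk.map fun d => .push d fun _ => some mark) ;;
    copy .t none ds

theorem fetch_does {src : Stk} {c : Γ'} {bk ds : List Stk} {s : Mem} {l rest : List Γ'}
    (hs : s.get src = l ++ c :: rest) (hc : c ∉ l) (ht : s.t = [])
    (h1 : src ∉ bk ++ [.t] := by decide) (h2 : (bk ++ [Stk.t]).Nodup := by decide)
    (h3 : .t ∉ ds := by decide) (h4 : ds.Nodup := by decide) :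
    Does (fetch src c bk ds) s (((s.set src rest).pushAll bk (l ++ [c])).pushAll ds l.reverse)
      (4 * l.length + 3) := by
  have hbk : bk.Nodup ∧ Stk.t ∉ bk := by
    rw [List.nodup_append] at h2
    exact ⟨h2.1, fun h => h2.2.2 _ h _ (by simp) rfl⟩
  have hsrc : src ≠ .t := fun h => h1 (by simp [h])
  have ht' : s.get .t = [] := ht
  have e1 := Does.copy_until hs hc h1 h2
  have e2 : Does (.ops (bk.map fun d => .push d fun _ => some c))
      ((s.set src rest).pushAll (bk ++ [.t]) l)
      (((s.set src rest).pushAll (bk ++ [.t]) l).pushAll bk [c]) 1 := .ops fun tm => by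
    rw [foldl_push bk _ c _ rfl, Mem.pushAll_withTmp]
    rfl
  have e3 := Does.copy_all (k := .t) (ds := ds) (l := l.reverse)
    (s := ((s.set src rest).pushAll (bk ++ [.t]) l).pushAll bk [c])
    (by
      rw [Mem.get_pushAll _ _ hbk.1, if_neg hbk.2, Mem.get_pushAll _ _ h2, if_pos (by simp),
        Mem.get_set, if_neg hsrc.symm, ht', List.append_nil]) h3 h4
  refine ((e1.seq (e2.seq e3)).mono (by simp; omega)).congr (congrArg (fun s : Mem => s.pushAll ds _) ?_)
  refine Mem.ext_get (by simp only [Mem.v_set, Mem.v_pushAll]) fun j => ?_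
  rw [Mem.get_set, Mem.get_pushAll _ _ hbk.1, Mem.get_pushAll _ _ h2, Mem.get_pushAll _ _ hbk.1,
    Mem.get_set]
  by_cases hj : j = .t
  · subst hj
    simp [hbk.2, hsrc.symm, ht']
  · by_cases hj' : j ∈ bk <;> simp [hj, hj']

/-- The word describing a vertex with the given number of counters and the given row of the
adjacency matrix. -/
def block (w row : List Bool) : List Γ' := .bra :: bits w ++ .comma :: bits row ++ [.ket]

/-! ### The program -/

/-- Processes the pair of a child `i` (or another vertex `i`) and a vertex `j`. The top of the stack
`q` is the entry `(i, j)` of the adjacency matrix, the top of `r` is the entry `(root, j)`, and the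
number of counters on `j` is read from `l3`. It is subtracted from `x` if `j` is a leaf below `i`, that
is, if the two entries are `1` and `0`: the entry of the root itself in its own row is a blank. -/
def leafBody : Prog :=
  .ops [.push .b3 fun _ => some .bra,
    .pop .q fun v c => {v with tmp := {v.tmp with c1 := c}},
    .pop .r fun v c => {v with tmp := {v.tmp with c2 := c}},
    .push .rb fun v => v.tmp.c2,
    .load fun v => {v with
      ok := v.ok && (!isOne v.tmp.c1 || (v.ci != isOne v.tmp.c2))
      sub := isOne v.tmp.c1 && decide (v.tmp.c2 = some (.bit false))}] ;;
  .ite (fun v => v.sub) (fetch .l3 .comma [.b3] [.w]) (fetch .l3 .comma [.b3] []) ;;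
  fetch .l3 .ket [.b3] [] ;;
  .ops [.pop .w fun v c => {v with tmp := {v.tmp with c1 := c}},
    .push .w fun v => v.tmp.c1,
    .load fun v => {v with pb := v.pb ^^ isOne v.tmp.c1, sub := false}] ;;
  subtract .x .w

/-- Processes all vertices `j` for a fixed vertex `i`. -/
def leafLoop : Prog :=
  .loop .l3 none leafBody ;; copy .b3 none [.l3] ;; copy .rb none [.r]

/-- Processes a vertex `i`, whose description is read from `l2`. The top of the stack `ri` tells
whether `i` is a child of the root. If so, and if `i` has `a` counters and `b` counters below it, then
`a - b` is subtracted from `y` if `b < a`, `a` is subtracted from `z` otherwise, and the parities are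
updated. -/
def childBody : Prog :=
  .ops [.push .b2 fun _ => some .bra] ;;
  fetch .l2 .comma [.b2] [.x, .a] ;;
  fetch .l2 .ket [.b2] [.q] ;;
  .ops [.pop .x fun v c => {v with tmp := {v.tmp with c1 := c}},
    .push .x fun v => v.tmp.c1,
    .pop .ri fun v c => {v with tmp := {v.tmp with c2 := c}},
    .load fun v => {v with pa := isOne v.tmp.c1, ci := isOne v.tmp.c2}] ;;
  leafLoop ;;
  testNonzero .x ;;
  .ite (fun v => v.ci)
    (.ite (fun v => v.nz)
      (.ops [.load fun v => {v with pQ := v.pQ ^^ v.pa, pB := v.pB ^^ v.pb}] ;; subtract .y .x)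
      (.ops [.load fun v => {v with pQ := v.pQ ^^ v.pa, pA := v.pA ^^ v.pa}] ;; subtract .z .a))
    (.ops []) ;;
  copy .x none [] ;; copy .a none [] ;;
  .ops [.load fun v => {v with ci := false, pa := false, pb := false, nz := false}]

/-- Processes all vertices `i` for a fixed root. -/
def childLoop : Prog := .loop .l2 none childBody ;; copy .b2 none [.l2]

/-- Reads the description of the root from `l1`. In its row, the entry of the root itself, whose
position is the height of the stack `u`, is replaced by a blank, so that the root is taken neither for
a child nor for a leaf. -/
def loadRoot : Prog :=
  fetch .l1 .comma [] [.y, .z] ;;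
  .ops [.pop .y fun v c => {v with tmp := {v.tmp with c1 := c}},
    .push .y fun v => v.tmp.c1,
    .load fun v => {v with pw := isOne v.tmp.c1, ok := true}] ;;
  fetch .l1 .ket [] [.r] ;;
  .loop .u none (.ops [.push .ub fun _ => some .blank,
    .pop .r fun v c => {v with tmp := {v.tmp with c1 := c}},
    .push .t fun v => v.tmp.c1]) ;;
  .ops [.pop .r fun v _ => v, .push .r fun _ => some .blank, .push .u fun _ => some .blank] ;;
  copy .t none [.r] ;; copy .ub none [.u] ;;
  copy .r none [.t] ;; copy .t none [.r, .ri]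

/-- Whether the next player wins according to the final values of the registers: the negation of
`PrevWins`, spelled out in terms of parities. -/
def Reg.nextWins (v : Reg) : Bool :=
  !(if v.fy then !v.pQ else if v.pB then (v.pA != v.pw) && (!v.pA == v.fz) else !v.pA && !v.pw)

/-- Tries out a vertex as the root. -/
def rootBody : Prog :=
  loadRoot ;; childLoop ;; copy .r none [] ;;
  testNonzero .y ;; .ops [.load fun v => {v with fy := v.nz}] ;; copy .y none [] ;;
  testNonzero .z ;; .ops [.load fun v => {v with fz := v.nz}] ;; copy .z none [] ;;
  .ops [.load fun v => {res := if v.ok then v.nextWins else v.res}]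

/-- The program computing the outcome. A copy of the input is kept for each of the three nested loops
over the vertices. -/
def solve : Prog :=
  copy .inp none [.t] ;; copy .t none [.l1, .l2, .l3] ;;
  .loop .l1 none rootBody ;;
  copy .l2 none [] ;; copy .l3 none [] ;; copy .u none []

/-! ### Effect of the parts of the program -/

theorem leafBody_does {s : Mem} {e : Bool} {c : Γ'} {w row x : List Bool} {Q R rest : List Γ'}
    (hq : s.q = .bit e :: Q) (hr : s.r = c :: R)
    (hl : s.l3 = bits w ++ .comma :: (bits row ++ .ket :: rest)) (ht : s.t = []) (hn : s.n = [])
    (hw : s.w = []) (hx : s.x = bits x) :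
    Does leafBody s {s with
      q := Q, r := R, rb := c :: s.rb, l3 := rest, b3 := (block w row).reverse ++ s.b3
      x := bits (monus x (if e && decide (c = .bit false) then w else []))
      v := {s.v with
        ok := s.v.ok && (!e || (s.v.ci != isOne (some c)))
        pb := s.v.pb ^^ ((if e && decide (c = .bit false) then w else []).headD false)
        sub := false}}
      (6 * w.length + 4 * row.length + 4 * x.length + 20) := by
  have h1 : Does (.ops [.push .b3 fun _ => some .bra,
      .pop .q fun v c => {v with tmp := {v.tmp with c1 := c}},
      .pop .r fun v c => {v with tmp := {v.tmp with c2 := c}},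
      .push .rb fun v => v.tmp.c2,
      .load fun v => {v with
        ok := v.ok && (!isOne v.tmp.c1 || (v.ci != isOne v.tmp.c2))
        sub := isOne v.tmp.c1 && decide (v.tmp.c2 = some (.bit false))}]) s
      {s with q := Q, r := R, rb := c :: s.rb, b3 := .bra :: s.b3, v := {s.v with
        ok := s.v.ok && (!e || (s.v.ci != isOne (some c)))
        sub := e && decide (c = .bit false)}} 1 := .ops fun tm => by
    simp [Op.run, Mem.withTmp, Mem.set, Mem.get, Mem.setReg, hq, hr, isOne_bit]
  obtain ⟨wv, hwv⟩ : ∃ wv, wv = if e && decide (c = .bit false) then w else [] := ⟨_, rfl⟩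
  rw [← hwv]
  have h2 : Does (.ite (fun v => v.sub) (fetch .l3 .comma [.b3] [.w]) (fetch .l3 .comma [.b3] []))
      {s with q := Q, r := R, rb := c :: s.rb, b3 := .bra :: s.b3, v := {s.v with
        ok := s.v.ok && (!e || (s.v.ci != isOne (some c)))
        sub := e && decide (c = .bit false)}}
      {s with q := Q, r := R, rb := c :: s.rb, l3 := bits row ++ .ket :: rest, w := bits wv
              b3 := .comma :: (bits w).reverse ++ .bra :: s.b3, v := {s.v with
        ok := s.v.ok && (!e || (s.v.ci != isOne (some c)))
        sub := e && decide (c = .bit false)}} (4 * w.length + 4) := by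
    cases hsub : (e && decide (c = .bit false))
    · refine .ite_false (fun _ => rfl) ?_
      refine Does.congr (.mono (fetch_does (l := bits w) hl (by simp) ht) (by simp)) ?_
      simp [Mem.pushAll, Mem.set, Mem.get, hwv, hsub, hw]
    · refine .ite_true (fun _ => rfl) ?_
      refine Does.congr (.mono (fetch_does (l := bits w) hl (by simp) ht) (by simp)) ?_
      simp [Mem.pushAll, Mem.set, Mem.get, hwv, hsub, hw]
  have h3 : Does (fetch .l3 .ket [.b3] []) _
      {s with q := Q, r := R, rb := c :: s.rb, l3 := rest, w := bits wv
              b3 := (block w row).reverse ++ s.b3, v := {s.v with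
        ok := s.v.ok && (!e || (s.v.ci != isOne (some c)))
        sub := e && decide (c = .bit false)}} _ :=
    (fetch_does (s := {s with q := Q, r := R, rb := c :: s.rb, l3 := bits row ++ .ket :: rest
                              w := bits wv, b3 := .comma :: (bits w).reverse ++ .bra :: s.b3
                              v := {s.v with
        ok := s.v.ok && (!e || (s.v.ci != isOne (some c)))
        sub := e && decide (c = .bit false)}}) (c := .ket) (l := bits row) (rest := rest) rfl
      (by simp) ht).congr (by simp [Mem.pushAll, Mem.set, Mem.get, block])
  have h4 : Does (.ops [.pop .w fun v c => {v with tmp := {v.tmp with c1 := c}},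
      .push .w fun v => v.tmp.c1,
      .load fun v => {v with pb := v.pb ^^ isOne v.tmp.c1, sub := false}])
      {s with q := Q, r := R, rb := c :: s.rb, l3 := rest, w := bits wv
              b3 := (block w row).reverse ++ s.b3, v := {s.v with
        ok := s.v.ok && (!e || (s.v.ci != isOne (some c)))
        sub := e && decide (c = .bit false)}}
      {s with q := Q, r := R, rb := c :: s.rb, l3 := rest, w := bits wv
              b3 := (block w row).reverse ++ s.b3, v := {s.v with
        ok := s.v.ok && (!e || (s.v.ci != isOne (some c)))
        pb := s.v.pb ^^ wv.headD false
        sub := false}} 1 := .ops fun tm => by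
    cases wv <;> simp [Op.run, Mem.withTmp, Mem.set, Mem.get, Mem.setReg, isOne]
  have h5 := subtract_does (k := .x) (src := .w) (x := x) (y := wv)
    (s := {s with q := Q, r := R, rb := c :: s.rb, l3 := rest, w := bits wv
                  b3 := (block w row).reverse ++ s.b3, v := {s.v with
        ok := s.v.ok && (!e || (s.v.ci != isOne (some c)))
        pb := s.v.pb ^^ wv.headD false
        sub := false}}) hx rfl hn
  have hlen : wv.length ≤ w.length := by
    rw [hwv]
    split_ifs <;> simp
  refine ((h1.seq (h2.seq (h3.seq (h4.seq h5)))).mono (by simp; omega)).congr ?_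
  simp [Mem.set, hw]

/-! ### Specification of the loops over the leaves and of the body of the loop over the children -/

section Loops

variable {ι : Type} (wt : ι → List Bool) (row : ι → List Bool)

/-- The word describing a list of vertices. -/
def blocks (js : List ι) : List Γ' := js.flatMap fun j => block (wt j) (row j)

theorem blocks_cons (j : ι) (js : List ι) : blocks wt row (j :: js) =
    .bra :: (bits (wt j) ++ .comma :: (bits (row j) ++ .ket :: blocks wt row js)) := by
  simp [blocks, block]

/-- The number of counters that a vertex with entry `e` in the row of a child and entry `c` in the
row of the root contributes to the counters below this child. -/
def leafWeight (e : Bool) (c : Γ') (w : List Bool) : ℕ :=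
  if e && decide (c = .bit false) then val w else 0

/-- The number of counters below a vertex with the entries `q` in its row; `rm` is the row of the
root. -/
def belowSum (q : ι → Bool) (rm : ι → Γ') (js : List ι) : ℕ :=
  (js.map fun j => leafWeight (q j) (rm j) (wt j)).sum

theorem val_ite_nil (b : Bool) (w : List Bool) :
    val (if b then w else []) = if b then val w else 0 := by
  cases b <;> rfl

theorem leafBody_loop_does (q : ι → Bool) (rm : ι → Γ') {N : ℕ}
    (hN : ∀ j, (wt j).length + (row j).length ≤ N) (js : List ι) (s : Mem) (x : List Bool)
    (hq : s.q = bits (js.map q)) (hr : s.r = js.map rm) (hl : s.l3 = blocks wt row js)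
    (ht : s.t = []) (hn : s.n = []) (hw : s.w = []) (hx : s.x = bits x) (hxN : x.length ≤ N)
    (hsub : s.v.sub = false) :
    ∃ x', x'.length ≤ x.length ∧ val x' = val x - belowSum wt q rm js ∧
      Does (.loop .l3 none leafBody) s {s with
        q := [], r := [], rb := (js.map rm).reverse ++ s.rb, l3 := []
        b3 := (blocks wt row js).reverse ++ s.b3
        x := bits x'
        v := {s.v with
          ok := s.v.ok && js.all fun j => !q j || (s.v.ci != isOne (some (rm j)))
          pb := s.v.pb ^^ (belowSum wt q rm js).bodd}} (js.length * (10 * N + 21) + 1) := by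
  induction js generalizing s x with
  | nil =>
    refine ⟨x, le_rfl, by simp [belowSum], ((Does.loop_nil (k := .l3) hl).mono (by simp)).congr ?_⟩
    rcases s with ⟨⟨_, _⟩, _⟩
    simp_all [belowSum, blocks]
  | cons j js ih =>
    rw [blocks_cons] at hl
    obtain ⟨s1, hs1, h1⟩ : ∃ s1, s1 = _ ∧ Does leafBody _ s1 _ := ⟨_, rfl,
      leafBody_does (s := s.set .l3 (bits (wt j) ++ .comma :: (bits (row j) ++ .ket ::
      blocks wt row js))) (e := q j) (Q := bits (js.map q)) (R := js.map rm) (c := rm j) (x := x)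
      (show s.q = _ by simpa using hq) hr rfl ht hn hw hx⟩
    obtain ⟨x', hx1, hx2, h2⟩ := ih s1 (monus x (if q j && decide (rm j = .bit false) then wt j else []))
      (by rw [hs1]) (by rw [hs1]) (by rw [hs1]) (by rw [hs1]; exact ht) (by rw [hs1]; exact hn)
      (by rw [hs1]; exact hw) (by rw [hs1]) ((length_monus_le _ _).trans hxN) (by rw [hs1])
    refine ⟨x', hx1.trans (length_monus_le _ _), ?_, ((Does.loop_cons (k := .l3) hl h1 h2).mono ?_).congr ?_⟩
    · rw [hx2, val_monus, val_ite_nil, Nat.sub_sub]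
      rfl
    · have := hN j
      rw [List.length_cons, add_mul]
      omega
    · have hb : belowSum wt q rm (j :: js) =
        val (if q j && decide (rm j = .bit false) then wt j else []) + belowSum wt q rm js := by
        rw [val_ite_nil]
        rfl
      rw [hb, Nat.bodd_add, bodd_val, hs1]
      simp [Mem.set, blocks_cons, block, hsub, Bool.and_assoc]

theorem leafLoop_does (q : ι → Bool) (rm : ι → Γ') {N : ℕ}
    (hN : ∀ j, (wt j).length + (row j).length ≤ N) (js : List ι) (s : Mem) (x : List Bool)
    (hq : s.q = bits (js.map q)) (hr : s.r = js.map rm) (hl : s.l3 = blocks wt row js)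
    (ht : s.t = []) (hn : s.n = []) (hw : s.w = []) (hx : s.x = bits x) (hxN : x.length ≤ N)
    (hsub : s.v.sub = false) (hrb : s.rb = []) (hb3 : s.b3 = [])
    (hjs : js.length ≤ N) (hbN : (blocks wt row js).length ≤ N) :
    ∃ x', x'.length ≤ x.length ∧ val x' = val x - belowSum wt q rm js ∧
      Does leafLoop s {s with
        q := [], x := bits x'
        v := {s.v with
          ok := s.v.ok && js.all fun j => !q j || (s.v.ci != isOne (some (rm j)))
          pb := s.v.pb ^^ (belowSum wt q rm js).bodd}} (N * (10 * N + 25) + 3) := by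
  obtain ⟨x', h1, h2, h3⟩ := leafBody_loop_does wt row q rm hN js s x hq hr hl ht hn hw hx hxN hsub
  refine ⟨x', h1, h2, ((h3.seq ((Does.copy_all rfl).seq (Does.copy_all rfl))).mono ?_).congr ?_⟩
  · simp only [Mem.get, Mem.pushAll, Mem.set, List.foldl_cons, List.foldl_nil, hrb, hb3,
      List.append_nil, List.length_reverse, List.length_map]
    have := Nat.mul_le_mul_right (10 * N + 21) hjs
    rw [show N * (10 * N + 25) = N * (10 * N + 21) + 4 * N by ring]
    omega
  · simp [Mem.get, Mem.pushAll, Mem.set, hrb, hb3, hl, hr]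

/-- The numbers on `y` and `z` after one round are described by their values only, as leading zeros
depend on how they were obtained. -/
theorem childBody_does (q : ι → Bool) (rm : ι → Γ') {N : ℕ}
    (hN : ∀ j, (wt j).length + (row j).length ≤ N) {js : List ι} {s : Mem} {a y z : List Bool}
    {c : Γ'} {rest RI : List Γ'}
    (hl2 : s.l2 = bits a ++ .comma :: (bits (js.map q) ++ .ket :: rest)) (hri : s.ri = c :: RI)
    (hl : s.l3 = blocks wt row js) (hr : s.r = js.map rm)
    (hy : s.y = bits y) (hz : s.z = bits z) (hyN : y.length ≤ N) (hzN : z.length ≤ N)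
    (haN : a.length ≤ N) (hjs : js.length ≤ N) (hbN : (blocks wt row js).length ≤ N)
    (ht : s.t = []) (hn : s.n = []) (hw : s.w = []) (hx : s.x = []) (ha : s.a = [])
    (hq : s.q = []) (hrb : s.rb = []) (hb3 : s.b3 = []) (hsub : s.v.sub = false)
    (hpb : s.v.pb = false) :
    ∃ y' z' : List Bool, y'.length ≤ N ∧ z'.length ≤ N ∧
      val y' = val y - (if isOne (some c) then val a - belowSum wt q rm js else 0) ∧
      val z' = val z - (if isOne (some c) then freePart (val a) (belowSum wt q rm js) else 0) ∧
      Does childBody s {s with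
        l2 := rest, ri := RI, b2 := (block a (js.map q)).reverse ++ s.b2, y := bits y', z := bits z'
        v := {s.v with
          ok := s.v.ok && js.all fun j => !q j || (isOne (some c) != isOne (some (rm j)))
          pQ := s.v.pQ ^^ (isOne (some c) && (val a).bodd)
          pA := s.v.pA ^^ (isOne (some c) && (freePart (val a) (belowSum wt q rm js)).bodd)
          pB := s.v.pB ^^ (isOne (some c) && (leafPart (val a) (belowSum wt q rm js)).bodd)
          ci := false, pa := false, pb := false, nz := false}}
        (N * (10 * N + 25) + 50 * N + 50) := by
  obtain ⟨s1, hs1⟩ : ∃ s1 : Mem, s1 = {s with b2 := .bra :: s.b2} := ⟨_, rfl⟩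
  have h1 : Does (.ops [.push .b2 fun _ => some .bra]) s s1 1 := .ops fun tm => by
    simp [hs1, Op.run, Mem.withTmp, Mem.set, Mem.get]
  obtain ⟨s2, hs2⟩ : ∃ s2 : Mem, s2 = {s with
    l2 := bits (js.map q) ++ .ket :: rest, b2 := .comma :: (bits a).reverse ++ .bra :: s.b2
    x := bits a, a := bits a} := ⟨_, rfl⟩
  have h2 : Does (fetch .l2 .comma [.b2] [.x, .a]) s1 s2 (4 * N + 3) := by
    refine Does.congr (.mono (fetch_does (l := bits a) (rest := bits (js.map q) ++ .ket :: rest)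
      (by rw [hs1]; exact hl2) (by simp) (by rw [hs1]; exact ht)) (by simpa using haN)) ?_
    simp [Mem.pushAll, Mem.set, Mem.get, hs1, hs2, hx, ha]
  obtain ⟨s3, hs3⟩ : ∃ s3 : Mem, s3 = {s with
    l2 := rest, b2 := (block a (js.map q)).reverse ++ s.b2
    x := bits a, a := bits a, q := bits (js.map q)} := ⟨_, rfl⟩
  have h3 : Does (fetch .l2 .ket [.b2] [.q]) s2 s3 (4 * N + 3) := by
    refine Does.congr (.mono (fetch_does (l := bits (js.map q)) (rest := rest)
      (by rw [hs2]; rfl) (by simp) (by rw [hs2]; exact ht)) (by simpa using hjs)) ?_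
    simp [Mem.pushAll, Mem.set, Mem.get, hs2, hs3, hq, block]
  obtain ⟨s4, hs4⟩ : ∃ s4 : Mem, s4 = {s with
    l2 := rest, b2 := (block a (js.map q)).reverse ++ s.b2, ri := RI
    x := bits a, a := bits a, q := bits (js.map q)
    v := {s.v with pa := a.headD false, ci := isOne (some c)}} := ⟨_, rfl⟩
  have h4 : Does (.ops [.pop .x fun v c => {v with tmp := {v.tmp with c1 := c}},
      .push .x fun v => v.tmp.c1,
      .pop .ri fun v c => {v with tmp := {v.tmp with c2 := c}},
      .load fun v => {v with pa := isOne v.tmp.c1, ci := isOne v.tmp.c2}]) s3 s4 1 :=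
    .ops fun tm => by
      cases a <;> simp [Op.run, Mem.withTmp, Mem.set, Mem.get, Mem.setReg, isOne, hs3, hs4, hri]
  obtain ⟨b, hb⟩ : ∃ b, b = belowSum wt q rm js := ⟨_, rfl⟩
  obtain ⟨x', hx1, hx2, h5⟩ := leafLoop_does wt row q rm hN js s4 a (by rw [hs4])
    (by rw [hs4]; exact hr) (by rw [hs4]; exact hl) (by rw [hs4]; exact ht) (by rw [hs4]; exact hn)
    (by rw [hs4]; exact hw) (by rw [hs4]) haN (by rw [hs4]; exact hsub) (by rw [hs4]; exact hrb)
    (by rw [hs4]; exact hb3) hjs hbN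
  rw [← hb] at hx2 h5 ⊢
  obtain ⟨ok', hok⟩ : ∃ ok', ok' =
    (s.v.ok && js.all fun j => !q j || (isOne (some c) != isOne (some (rm j)))) := ⟨_, rfl⟩
  rw [← hok]
  obtain ⟨s5, hs5⟩ : ∃ s5 : Mem, s5 = {s with
    l2 := rest, b2 := (block a (js.map q)).reverse ++ s.b2, ri := RI
    x := bits x', a := bits a
    v := {s.v with pa := a.headD false, ci := isOne (some c), ok := ok', pb := b.bodd}} := ⟨_, rfl⟩
  replace h5 := h5.congr (s'' := s5) (by simp [hs4, hs5, hq, hok, hpb])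
  have hx1N := hx1.trans haN
  have h6 := (testNonzero_does (k := .x) (x := x') (s := s5) (by rw [hs5]; rfl)
    (by rw [hs5]; exact hn)).mono (t' := 4 * N + 3) (by omega)
  obtain ⟨s6, hs6⟩ : ∃ s6 : Mem, s6 = {s with
    l2 := rest, b2 := (block a (js.map q)).reverse ++ s.b2, ri := RI
    x := bits x', a := bits a
    v := {s.v with
      pa := a.headD false, ci := isOne (some c), ok := ok', pb := b.bodd
      nz := decide (b < val a)}} := ⟨_, rfl⟩
  replace h6 := h6.congr (s'' := s6) (by simp [hs5, hs6, Mem.setReg, hx2, Nat.sub_eq_zero_iff_le])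
  have h7 : ∃ y' z' x'' a' : List Bool, y'.length ≤ N ∧ z'.length ≤ N ∧
      x''.length ≤ N ∧ a'.length ≤ N ∧
      val y' = val y - (if isOne (some c) then val a - b else 0) ∧
      val z' = val z - (if isOne (some c) then freePart (val a) b else 0) ∧
      Does (.ite (fun v => v.ci)
        (.ite (fun v => v.nz)
          (.ops [.load fun v => {v with pQ := v.pQ ^^ v.pa, pB := v.pB ^^ v.pb}] ;; subtract .y .x)
          (.ops [.load fun v => {v with pQ := v.pQ ^^ v.pa, pA := v.pA ^^ v.pa}] ;;
            subtract .z .a))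
        (.ops [])) s6 {s6 with
          y := bits y', z := bits z', x := bits x'', a := bits a'
          v := {s6.v with
            pQ := s.v.pQ ^^ (isOne (some c) && (val a).bodd)
            pA := s.v.pA ^^ (isOne (some c) && (freePart (val a) b).bodd)
            pB := s.v.pB ^^ (isOne (some c) && (leafPart (val a) b).bodd)}} (6 * N + 8) := by
    cases hc : isOne (some c)
    · refine ⟨y, z, x', a, hyN, hzN, hx1N, haN, by simp, by simp,
        .ite_false (t := 6 * N + 7) (fun _ => by rw [hs6]; exact hc) (.mono (.ops fun _ => ?_) (by omega))⟩
      simp [hs6, Mem.withTmp, hy, hz]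
    · by_cases hab : b < val a
      · refine ⟨monus y x', z, [], a, (length_monus_le _ _).trans hyN, hzN, by simp, haN,
          by simp [val_monus, hx2], by simp [freePart, hab.not_ge],
          .ite_true (t := 6 * N + 7) (fun _ => by rw [hs6]; exact hc)
            (.ite_true (t := 6 * N + 6) (fun _ => by rw [hs6]; simpa [Mem.withTmp] using hab) ?_)⟩
        have h1 : Does (.ops [.load fun v => {v with pQ := v.pQ ^^ v.pa, pB := v.pB ^^ v.pb}]) s6
            {s6 with v := {s6.v with
              pQ := s6.v.pQ ^^ s6.v.pa, pB := s6.v.pB ^^ s6.v.pb}} 1 := .ops fun _ => rfl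
        refine ((h1.seq (subtract_does (k := .y) (src := .x) (x := y) (y := x')
          (by rw [hs6]; exact hy) (by rw [hs6]; rfl) (by rw [hs6]; exact hn))).mono
          (by omega)).congr ?_
        simp [hs6, Mem.set, hz, bodd_val, freePart, leafPart, hab.not_ge]
      · refine ⟨y, monus z a, x', [], hyN, (length_monus_le _ _).trans hzN, hx1N, by simp,
          by simp [Nat.sub_eq_zero_of_le (not_lt.1 hab)],
          by simp [val_monus, freePart, not_lt.1 hab],
          .ite_true (t := 6 * N + 7) (fun _ => by rw [hs6]; exact hc)
            (.ite_false (t := 6 * N + 6) (fun _ => by rw [hs6]; simpa [Mem.withTmp] using hab) ?_)⟩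
        have h1 : Does (.ops [.load fun v => {v with pQ := v.pQ ^^ v.pa, pA := v.pA ^^ v.pa}]) s6
            {s6 with v := {s6.v with
              pQ := s6.v.pQ ^^ s6.v.pa, pA := s6.v.pA ^^ s6.v.pa}} 1 := .ops fun _ => rfl
        refine ((h1.seq (subtract_does (k := .z) (src := .a) (x := z) (y := a)
          (by rw [hs6]; exact hz) (by rw [hs6]; rfl) (by rw [hs6]; exact hn))).mono
          (by omega)).congr ?_
        simp [hs6, Mem.set, hy, bodd_val, freePart, leafPart, not_lt.1 hab]
  obtain ⟨y', z', x'', a', hy', hz', hx'', ha', ey, ez, h7⟩ := h7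
  refine ⟨y', z', hy', hz', ey, ez, ?_⟩
  have h8 := (h7.seq ((Does.copy_all (k := .x) (ds := []) (l := bits x'') rfl).seq
    ((Does.copy_all (k := .a) (ds := []) (l := bits a') rfl).seq (Does.ops (l := [.load fun v =>
      {v with ci := false, pa := false, pb := false, nz := false}]) (s' := {s with
        l2 := rest, ri := RI, b2 := (block a (js.map q)).reverse ++ s.b2, y := bits y', z := bits z'
        v := {s.v with
          ok := ok'
          pQ := s.v.pQ ^^ (isOne (some c) && (val a).bodd)
          pA := s.v.pA ^^ (isOne (some c) && (freePart (val a) b).bodd)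
          pB := s.v.pB ^^ (isOne (some c) && (leafPart (val a) b).bodd)
          ci := false, pa := false, pb := false, nz := false}}) fun tm => by
      simp [hs6, Op.run, Mem.withTmp, Mem.set, Mem.pushAll, Mem.setReg, hx, ha]))))
  refine (h1.seq (h2.seq (h3.seq (h4.seq (h5.seq (h6.seq h8)))))).mono ?_
  simp only [List.length_map]
  omega

end Loops

/-! ### Specification of the loop over the children and of the loading of a root -/

section Roots

variable {ι : Type} (wt : ι → List Bool) (e : ι → ι → Bool) (vs : List ι)

/-- The sum of `f w b` over the children `i` of the root with row `rm` in the list `is`, where `w` is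
the number of counters on `i` and `b` the number of counters below `i`. -/
def childSum (f : ℕ → ℕ → ℕ) (rm : ι → Γ') (is : List ι) : ℕ :=
  (is.map fun i => if isOne (some (rm i)) then f (val (wt i)) (belowSum wt (e i) rm vs) else 0).sum

theorem childSum_cons (f : ℕ → ℕ → ℕ) (rm : ι → Γ') (i : ι) (is : List ι) :
    childSum wt e vs f rm (i :: is) =
      (if isOne (some (rm i)) then f (val (wt i)) (belowSum wt (e i) rm vs) else 0) +
        childSum wt e vs f rm is := by
  simp [childSum]

theorem bodd_ite (b : Bool) (n : ℕ) : (if b then n else 0).bodd = (b && n.bodd) := by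
  cases b <;> simp

/-- The test whether every edge between `is` and `vs` joins vertices of which exactly one is adjacent
to the root with row `rm`. -/
def crossTest (rm : ι → Γ') (is : List ι) : Bool :=
  is.all fun i => vs.all fun j => !e i j || (isOne (some (rm i)) != isOne (some (rm j)))

theorem childBody_loop_does (rm : ι → Γ') {N : ℕ}
    (hN : ∀ j, (wt j).length + vs.length ≤ N) (is : List ι) (s : Mem) (y z : List Bool)
    (hl2 : s.l2 = blocks wt (fun i => vs.map (e i)) is) (hri : s.ri = is.map rm)
    (hl : s.l3 = blocks wt (fun i => vs.map (e i)) vs) (hr : s.r = vs.map rm)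
    (hy : s.y = bits y) (hz : s.z = bits z) (hyN : y.length ≤ N) (hzN : z.length ≤ N)
    (hjs : vs.length ≤ N) (hbN : (blocks wt (fun i => vs.map (e i)) vs).length ≤ N)
    (ht : s.t = []) (hn : s.n = []) (hw : s.w = []) (hx : s.x = []) (ha : s.a = [])
    (hq : s.q = []) (hrb : s.rb = []) (hb3 : s.b3 = []) (hsub : s.v.sub = false)
    (hpb : s.v.pb = false) (hci : s.v.ci = false) (hpa : s.v.pa = false) (hnz : s.v.nz = false) :
    ∃ y' z' : List Bool, y'.length ≤ N ∧ z'.length ≤ N ∧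
      val y' = val y - childSum wt e vs (fun a b => a - b) rm is ∧
      val z' = val z - childSum wt e vs freePart rm is ∧
      Does (.loop .l2 none childBody) s {s with
        l2 := [], ri := [], b2 := (blocks wt (fun i => vs.map (e i)) is).reverse ++ s.b2
        y := bits y', z := bits z'
        v := {s.v with
          ok := s.v.ok && crossTest e vs rm is
          pQ := s.v.pQ ^^ (childSum wt e vs (fun a _ => a) rm is).bodd
          pA := s.v.pA ^^ (childSum wt e vs freePart rm is).bodd
          pB := s.v.pB ^^ (childSum wt e vs leafPart rm is).bodd}}
        (is.length * (N * (10 * N + 25) + 50 * N + 51) + 1) := by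
  induction is generalizing s y z with
  | nil =>
    refine ⟨y, z, hyN, hzN, by simp [childSum], by simp [childSum],
      ((Does.loop_nil (k := .l2) hl2).mono (by simp)).congr ?_⟩
    rcases s with ⟨⟨_, _⟩, _⟩
    simp_all [childSum, blocks, crossTest]
  | cons i is ih =>
    rw [blocks_cons] at hl2
    obtain ⟨y1, z1, hy1, hz1, ey1, ez1, h1⟩ := childBody_does wt (fun i => vs.map (e i)) (e i) rm
      (N := N) (by simpa using hN) (js := vs)
      (s := s.set .l2 (bits (wt i) ++ .comma :: (bits (vs.map (e i)) ++ .ket ::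
        blocks wt (fun i => vs.map (e i)) is))) (c := rm i) (RI := is.map rm) rfl
      (show s.ri = _ by simpa using hri) hl hr hy hz hyN hzN ((Nat.le_add_right _ _).trans (hN i))
      hjs hbN ht hn hw hx ha hq hrb hb3 hsub hpb
    obtain ⟨s1, hs1, h1⟩ : ∃ s1, s1 = _ ∧ Does childBody _ s1 _ := ⟨_, rfl, h1⟩
    obtain ⟨y2, z2, hy2, hz2, ey2, ez2, h2⟩ := ih s1 y1 z1 (by rw [hs1]) (by rw [hs1])
      (by rw [hs1]; exact hl) (by rw [hs1]; exact hr) (by rw [hs1]) (by rw [hs1]) hy1 hz1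
      (by rw [hs1]; exact ht) (by rw [hs1]; exact hn) (by rw [hs1]; exact hw)
      (by rw [hs1]; exact hx) (by rw [hs1]; exact ha) (by rw [hs1]; exact hq)
      (by rw [hs1]; exact hrb) (by rw [hs1]; exact hb3) (by rw [hs1]; exact hsub) (by rw [hs1])
      (by rw [hs1]) (by rw [hs1]) (by rw [hs1])
    refine ⟨y2, z2, hy2, hz2, ?_, ?_, ((Does.loop_cons (k := .l2) hl2 h1 h2).mono ?_).congr ?_⟩
    · rw [ey2, ey1, Nat.sub_sub, childSum_cons]
    · rw [ez2, ez1, Nat.sub_sub, childSum_cons]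
    · rw [List.length_cons, add_mul]
      omega
    · simp only [childSum_cons, Nat.bodd_add, bodd_ite]
      rw [hs1]
      simp [Mem.set, blocks_cons, block, crossTest, Bool.and_assoc, hci, hpa, hpb, hnz]

theorem childLoop_does (rm : ι → Γ') {N : ℕ}
    (hN : ∀ j, (wt j).length + vs.length ≤ N) (s : Mem) (y z : List Bool)
    (hl2 : s.l2 = blocks wt (fun i => vs.map (e i)) vs) (hri : s.ri = vs.map rm)
    (hl : s.l3 = blocks wt (fun i => vs.map (e i)) vs) (hr : s.r = vs.map rm)
    (hy : s.y = bits y) (hz : s.z = bits z) (hyN : y.length ≤ N) (hzN : z.length ≤ N)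
    (hjs : vs.length ≤ N) (hbN : (blocks wt (fun i => vs.map (e i)) vs).length ≤ N)
    (ht : s.t = []) (hn : s.n = []) (hw : s.w = []) (hx : s.x = []) (ha : s.a = [])
    (hq : s.q = []) (hrb : s.rb = []) (hb3 : s.b3 = []) (hb2 : s.b2 = []) (hsub : s.v.sub = false)
    (hpb : s.v.pb = false) (hci : s.v.ci = false) (hpa : s.v.pa = false) (hnz : s.v.nz = false) :
    ∃ y' z' : List Bool, y'.length ≤ N ∧ z'.length ≤ N ∧
      val y' = val y - childSum wt e vs (fun a b => a - b) rm vs ∧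
      val z' = val z - childSum wt e vs freePart rm vs ∧
      Does childLoop s {s with
        ri := [], y := bits y', z := bits z'
        v := {s.v with
          ok := s.v.ok && crossTest e vs rm vs
          pQ := s.v.pQ ^^ (childSum wt e vs (fun a _ => a) rm vs).bodd
          pA := s.v.pA ^^ (childSum wt e vs freePart rm vs).bodd
          pB := s.v.pB ^^ (childSum wt e vs leafPart rm vs).bodd}}
        (N * (N * (10 * N + 25) + 50 * N + 53) + 2) := by
  obtain ⟨y', z', h1, h2, h3, h4, h5⟩ := childBody_loop_does wt e vs rm hN vs s y z hl2 hri hl hr hy hz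
    hyN hzN hjs hbN ht hn hw hx ha hq hrb hb3 hsub hpb hci hpa hnz
  refine ⟨y', z', h1, h2, h3, h4, ((h5.seq (Does.copy_all rfl)).mono ?_).congr ?_⟩
  · simp only [Mem.get, hb2, List.append_nil, List.length_reverse]
    have := Nat.mul_le_mul_right (N * (10 * N + 25) + 50 * N + 51) hjs
    rw [show N * (N * (10 * N + 25) + 50 * N + 53) =
      N * (N * (10 * N + 25) + 50 * N + 51) + 2 * N by ring]
    omega
  · simp [Mem.get, Mem.pushAll, Mem.set, hb2, hl2]

theorem loadRoot_loop_does {k : ℕ} {s : Mem} {l : List Γ'} (hu : s.u = List.replicate k .blank)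
    (hr : s.r = l) (hk : k ≤ l.length) :
    Does (.loop .u none (.ops [.push .ub fun _ => some .blank,
      .pop .r fun v c => {v with tmp := {v.tmp with c1 := c}}, .push .t fun v => v.tmp.c1])) s
      {s with
        u := [], ub := List.replicate k .blank ++ s.ub, r := l.drop k, t := (l.take k).reverse ++ s.t}
      (2 * k + 1) := by
  induction k generalizing s l with
  | zero =>
    refine ((Does.loop_nil (k := .u) hu).mono (by simp)).congr ?_
    cases s
    simp_all
  | succ k ih =>
    obtain - | ⟨c, l⟩ := l
    · simp at hk
    obtain ⟨s1, hs1⟩ : ∃ s1 : Mem, s1 = {s with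
      u := List.replicate k .blank, ub := .blank :: s.ub, r := l, t := c :: s.t} := ⟨_, rfl⟩
    have h1 : Does (.ops [.push .ub fun _ => some .blank,
        .pop .r fun v c => {v with tmp := {v.tmp with c1 := c}}, .push .t fun v => v.tmp.c1])
        (s.set .u (List.replicate k .blank)) s1 1 := .ops fun tm => by
      simp [Op.run, Mem.withTmp, Mem.set, Mem.get, Mem.setReg, hs1, hr]
    have h2 := ih (s := s1) (l := l) (by rw [hs1]) (by rw [hs1]) (by simpa using hk)
    refine ((Does.loop_cons (k := .u) hu h1 h2).mono (by omega)).congr ?_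
    simp [hs1, List.replicate_succ']

theorem loadRoot_does {s : Mem} {w row : List Bool} {rest : List Γ'} {k : ℕ}
    (hl : s.l1 = bits w ++ .comma :: (bits row ++ .ket :: rest))
    (hu : s.u = List.replicate k .blank) (hk : k < row.length) (ht : s.t = []) (hy : s.y = [])
    (hz : s.z = []) (hr : s.r = []) (hri : s.ri = []) (hub : s.ub = []) :
    Does loadRoot s {s with
      l1 := rest, y := bits w, z := bits w, r := (bits row).set k .blank
      ri := (bits row).set k .blank, u := List.replicate (k + 1) .blank
      v := {s.v with pw := w.headD false, ok := true}} (4 * w.length + 20 * row.length + 20) := by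
  obtain ⟨s1, hs1⟩ : ∃ s1 : Mem, s1 = {s with
    l1 := bits row ++ .ket :: rest, y := bits w, z := bits w} := ⟨_, rfl⟩
  have h1 : Does (fetch .l1 .comma [] [.y, .z]) s s1 (4 * w.length + 3) := by
    refine Does.congr (.mono (fetch_does (l := bits w) (rest := bits row ++ .ket :: rest)
      hl (by simp) ht) (by simp)) ?_
    simp [Mem.pushAll, Mem.set, Mem.get, hs1, hy, hz]
  obtain ⟨s2, hs2⟩ : ∃ s2 : Mem, s2 = {s with
    l1 := bits row ++ .ket :: rest, y := bits w, z := bits w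
    v := {s.v with pw := w.headD false, ok := true}} := ⟨_, rfl⟩
  have h2 : Does (.ops [.pop .y fun v c => {v with tmp := {v.tmp with c1 := c}},
      .push .y fun v => v.tmp.c1,
      .load fun v => {v with pw := isOne v.tmp.c1, ok := true}]) s1 s2 1 := .ops fun tm => by
    cases w <;> simp [Op.run, Mem.withTmp, Mem.set, Mem.get, Mem.setReg, isOne, hs1, hs2]
  obtain ⟨s3, hs3⟩ : ∃ s3 : Mem, s3 = {s with
    l1 := rest, y := bits w, z := bits w, r := bits row
    v := {s.v with pw := w.headD false, ok := true}} := ⟨_, rfl⟩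
  have h3 : Does (fetch .l1 .ket [] [.r]) s2 s3 (4 * row.length + 3) := by
    refine Does.congr (.mono (fetch_does (l := bits row) (rest := rest)
      (by rw [hs2]; rfl) (by simp) (by rw [hs2]; exact ht)) (by simp)) ?_
    simp [Mem.pushAll, Mem.set, Mem.get, hs2, hs3, hr]
  have h4 := loadRoot_loop_does (s := s3) (k := k) (l := bits row) (by rw [hs3]; exact hu)
    (by rw [hs3]) (by simpa using hk.le)
  obtain ⟨s4, hs4⟩ : ∃ s4 : Mem, s4 = {s with
    l1 := rest, y := bits w, z := bits w, r := .blank :: (bits row).drop (k + 1)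
    t := ((bits row).take k).reverse, ub := List.replicate k .blank, u := [.blank]
    v := {s.v with pw := w.headD false, ok := true}} := ⟨_, rfl⟩
  have h5 : Does (.ops [.pop .r fun v _ => v, .push .r fun _ => some .blank,
      .push .u fun _ => some .blank]) {s3 with
        u := [], ub := List.replicate k .blank ++ s3.ub, r := (bits row).drop k
        t := ((bits row).take k).reverse ++ s3.t} s4 1 := .ops fun tm => by
    simp [Op.run, Mem.withTmp, Mem.set, Mem.get, Mem.setReg, hs3, hs4, hub, ht]
  have e : (bits row).set k .blank = (bits row).take k ++ .blank :: (bits row).drop (k + 1) :=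
    List.set_eq_take_append_cons_drop.trans (if_pos (by simpa using hk))
  obtain ⟨s5, hs5⟩ : ∃ s5 : Mem, s5 = {s with
    l1 := rest, y := bits w, z := bits w, r := (bits row).set k .blank
    t := [], ub := List.replicate k .blank, u := [.blank]
    v := {s.v with pw := w.headD false, ok := true}} := ⟨_, rfl⟩
  have h6 : Does (copy .t none [.r]) s4 s5 (2 * k + 1) := by
    refine ((Does.copy_all (l := ((bits row).take k).reverse) (by rw [hs4]; rfl)).mono ?_).congr ?_
    · simp
    · simp [hs4, hs5, Mem.pushAll, Mem.set, Mem.get, e]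
  obtain ⟨s6, hs6⟩ : ∃ s6 : Mem, s6 = {s with
    l1 := rest, y := bits w, z := bits w, r := (bits row).set k .blank
    t := [], ub := [], u := List.replicate (k + 1) .blank
    v := {s.v with pw := w.headD false, ok := true}} := ⟨_, rfl⟩
  have h7 : Does (copy .ub none [.u]) s5 s6 (2 * k + 1) := by
    refine ((Does.copy_all (l := List.replicate k .blank) (by rw [hs5]; rfl)).mono ?_).congr ?_
    · simp
    · simp [hs5, hs6, Mem.pushAll, Mem.set, Mem.get, List.replicate_succ']
  obtain ⟨s7, hs7⟩ : ∃ s7 : Mem, s7 = {s with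
    l1 := rest, y := bits w, z := bits w, r := []
    t := ((bits row).set k .blank).reverse, ub := [], u := List.replicate (k + 1) .blank
    v := {s.v with pw := w.headD false, ok := true}} := ⟨_, rfl⟩
  have h8 : Does (copy .r none [.t]) s6 s7 (2 * row.length + 1) := by
    refine ((Does.copy_all (l := (bits row).set k .blank) (by rw [hs6]; rfl)).mono ?_).congr ?_
    · simp
    · simp [hs6, hs7, Mem.pushAll, Mem.set, Mem.get]
  have h9 : Does (copy .t none [.r, .ri]) s7 {s with
      l1 := rest, y := bits w, z := bits w, r := (bits row).set k .blank
      ri := (bits row).set k .blank, u := List.replicate (k + 1) .blank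
      v := {s.v with pw := w.headD false, ok := true}} (2 * row.length + 1) := by
    refine ((Does.copy_all (l := ((bits row).set k .blank).reverse) (by rw [hs7]; rfl)).mono
      ?_).congr ?_
    · simp
    · simp [hs7, Mem.pushAll, Mem.set, Mem.get, hri, hub, ht]
  refine (h1.seq (h2.seq (h3.seq (h4.seq (h5.seq (h6.seq (h7.seq (h8.seq h9)))))))).mono ?_
  omega

end Roots

/-! ### Specification of the loop over the roots -/

section Solve

variable {ι : Type} (wt : ι → List Bool) (e : ι → ι → Bool) (vs : List ι)

/-- Whether the next player wins, computed for a root with `w` as its number of counters and `rm` as its row. -/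
def winTest (w : List Bool) (rm : ι → Γ') : Bool :=
  Reg.nextWins {
    fy := decide (childSum wt e vs (fun a b => a - b) rm vs < val w)
    fz := decide (childSum wt e vs freePart rm vs < val w)
    pQ := (childSum wt e vs (fun a _ => a) rm vs).bodd
    pA := (childSum wt e vs freePart rm vs).bodd
    pB := (childSum wt e vs leafPart rm vs).bodd
    pw := (val w).bodd }

theorem rootBody_does (rm : ι → Γ') {N k : ℕ}
    (hN : ∀ j, (wt j).length + vs.length ≤ N) (s : Mem) (r : ι) {rest : List Γ'}
    (hl1 : s.l1 = bits (wt r) ++ .comma :: (bits (vs.map (e r)) ++ .ket :: rest))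
    (hrm : (bits (vs.map (e r))).set k .blank = vs.map rm)
    (hl2 : s.l2 = blocks wt (fun i => vs.map (e i)) vs)
    (hl : s.l3 = blocks wt (fun i => vs.map (e i)) vs) (hk : k < vs.length)
    (hbN : (blocks wt (fun i => vs.map (e i)) vs).length ≤ N) {ρ : Bool}
    (hs : s = {l1 := s.l1, l2 := s.l2, l3 := s.l3, u := List.replicate k .blank, v := {res := ρ}}) :
    Does rootBody s {
        l1 := rest, l2 := s.l2, l3 := s.l3, u := List.replicate (k + 1) .blank
        v := {res := if crossTest e vs rm vs then winTest wt e vs (wt r) rm else ρ}}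
      (N * (N * (10 * N + 25) + 50 * N + 53) + 40 * N + 50) := by
  have hwN : (wt r).length ≤ N := (Nat.le_add_right _ _).trans (hN r)
  have hvN : vs.length ≤ N := (Nat.le_add_left _ _).trans (hN r)
  obtain ⟨s1, hs1⟩ : ∃ s1 : Mem, s1 = {
    l1 := rest, l2 := s.l2, l3 := s.l3, u := List.replicate (k + 1) .blank
    y := bits (wt r), z := bits (wt r), r := vs.map rm, ri := vs.map rm
    v := {res := ρ, pw := (val (wt r)).bodd, ok := true}} := ⟨_, rfl⟩
  have h1 : Does loadRoot s s1 (24 * N + 20) := by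
    refine ((loadRoot_does hl1 (by rw [hs]) (by simpa using hk) (by rw [hs]) (by rw [hs])
      (by rw [hs]) (by rw [hs]) (by rw [hs]) (by rw [hs])).mono ?_).congr ?_
    · rw [List.length_map]
      omega
    · rw [hs1, bodd_val, hrm, hs]
  obtain ⟨y, z, hy, hz, ey, ez, h2⟩ := childLoop_does wt e vs rm hN s1 (wt r) (wt r)
    (by rw [hs1]; exact hl2) (by rw [hs1]) (by rw [hs1]; exact hl) (by rw [hs1]) (by rw [hs1])
    (by rw [hs1]) hwN hwN hvN hbN (by rw [hs1]) (by rw [hs1]) (by rw [hs1]) (by rw [hs1])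
    (by rw [hs1]) (by rw [hs1]) (by rw [hs1]) (by rw [hs1]) (by rw [hs1]) (by rw [hs1]) (by rw [hs1])
    (by rw [hs1]) (by rw [hs1]) (by rw [hs1])
  obtain ⟨v2, hv2⟩ : ∃ v2 : Reg, v2 = {
    res := ρ, pw := (val (wt r)).bodd, ok := crossTest e vs rm vs
    pQ := (childSum wt e vs (fun a _ => a) rm vs).bodd
    pA := (childSum wt e vs freePart rm vs).bodd
    pB := (childSum wt e vs leafPart rm vs).bodd} := ⟨_, rfl⟩
  obtain ⟨s2, hs2⟩ : ∃ s2 : Mem, s2 = {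
    l1 := rest, l2 := s.l2, l3 := s.l3, u := List.replicate (k + 1) .blank
    y := bits y, z := bits z, r := vs.map rm, v := v2} := ⟨_, rfl⟩
  replace h2 := h2.congr (s'' := s2) (by simp [hs1, hs2, hv2])
  obtain ⟨s3, hs3⟩ : ∃ s3 : Mem, s3 = {
    l1 := rest, l2 := s.l2, l3 := s.l3, u := List.replicate (k + 1) .blank
    y := bits y, z := bits z, v := v2} := ⟨_, rfl⟩
  have h3 : Does (copy .r none []) s2 s3 (2 * N + 1) := by
    refine ((Does.copy_all (l := vs.map rm) (by rw [hs2]; rfl)).mono ?_).congr ?_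
    · simpa using hvN
    · simp [hs2, hs3, Mem.pushAll, Mem.set]
  have h4 := (testNonzero_does (k := .y) (x := y) (s := s3) (by rw [hs3]; rfl)
    (by rw [hs3]; rfl)).mono (t' := 4 * N + 3) (by omega)
  obtain ⟨s5, hs5⟩ : ∃ s5 : Mem, s5 = {
    l1 := rest, l2 := s.l2, l3 := s.l3, u := List.replicate (k + 1) .blank
    y := bits y, z := bits z, v := {v2 with nz := decide (val y ≠ 0), fy := decide (val y ≠ 0)}} :=
    ⟨_, rfl⟩
  have h5 : Does (.ops [.load fun v => {v with fy := v.nz}]) _ s5 1 :=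
    .ops (s := s3.setReg {s3.v with nz := decide (val y ≠ 0)}) fun tm => by
      simp [hs3, hs5, Op.run, Mem.withTmp, Mem.setReg]
  obtain ⟨s6, hs6⟩ : ∃ s6 : Mem, s6 = {
    l1 := rest, l2 := s.l2, l3 := s.l3, u := List.replicate (k + 1) .blank
    z := bits z, v := {v2 with nz := decide (val y ≠ 0), fy := decide (val y ≠ 0)}} := ⟨_, rfl⟩
  have h6 : Does (copy .y none []) s5 s6 (2 * N + 1) := by
    refine ((Does.copy_all (l := bits y) (by rw [hs5]; rfl)).mono ?_).congr ?_
    · simpa using hy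
    · simp [hs5, hs6, Mem.pushAll, Mem.set]
  have h7 := (testNonzero_does (k := .z) (x := z) (s := s6) (by rw [hs6]; rfl)
    (by rw [hs6]; rfl)).mono (t' := 4 * N + 3) (by omega)
  obtain ⟨v8, hv8⟩ : ∃ v8 : Reg, v8 = {v2 with
    nz := decide (val z ≠ 0), fy := decide (val y ≠ 0), fz := decide (val z ≠ 0)} := ⟨_, rfl⟩
  obtain ⟨s8, hs8⟩ : ∃ s8 : Mem, s8 = {
    l1 := rest, l2 := s.l2, l3 := s.l3, u := List.replicate (k + 1) .blank
    z := bits z, v := v8} := ⟨_, rfl⟩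
  have h8 : Does (.ops [.load fun v => {v with fz := v.nz}]) _ s8 1 :=
    .ops (s := s6.setReg {s6.v with nz := decide (val z ≠ 0)}) fun tm => by
      simp [hs6, hs8, hv8, Op.run, Mem.withTmp, Mem.setReg]
  obtain ⟨s9, hs9⟩ : ∃ s9 : Mem, s9 = {
    l1 := rest, l2 := s.l2, l3 := s.l3, u := List.replicate (k + 1) .blank, v := v8} := ⟨_, rfl⟩
  have h9 : Does (copy .z none []) s8 s9 (2 * N + 1) := by
    refine ((Does.copy_all (l := bits z) (by rw [hs8]; rfl)).mono ?_).congr ?_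
    · simpa using hz
    · simp [hs8, hs9, Mem.pushAll, Mem.set]
  have h10 : Does (.ops [.load fun v => {res := if v.ok then v.nextWins else v.res}]) s9 {
        l1 := rest, l2 := s.l2, l3 := s.l3, u := List.replicate (k + 1) .blank
        v := {res := if crossTest e vs rm vs then winTest wt e vs (wt r) rm else ρ}} 1 :=
    .ops fun tm => by
      simp [hs9, hv8, hv2, Op.run, Mem.withTmp, Mem.setReg, Reg.nextWins, winTest, ey, ez,
        Nat.sub_eq_zero_iff_le]
  refine (h1.seq (h2.seq (h3.seq (h4.seq (h5.seq (h6.seq (h7.seq (h8.seq (h9.seq h10))))))))).mono ?_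
  omega

theorem length_le_length_blocks (js : List ι) (row : ι → List Bool) :
    js.length ≤ (blocks wt row js).length ∧
      ∀ j ∈ js, (wt j).length + (row j).length ≤ (blocks wt row js).length := by
  induction js with
  | nil => simp
  | cons j js ih =>
    rw [blocks_cons]
    simp only [List.length_cons, List.length_append, List.length_map, List.mem_cons]
    refine ⟨by omega, ?_⟩
    rintro i (rfl | hi)
    · omega
    · have := ih.2 i hi
      omega

variable [DecidableEq ι]

/-- The row of `r` in the adjacency matrix, with the entry of `r` itself marked by a blank. -/
def rootRow (r j : ι) : Γ' := if j = r then .blank else .bit (e r j)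

theorem set_blank_eq_map_rootRow (pre suf : List ι) (r : ι) (h : (pre ++ r :: suf).Nodup) :
    (bits ((pre ++ r :: suf).map (e r))).set pre.length .blank =
      (pre ++ r :: suf).map (rootRow e r) := by
  have h1 : r ∉ pre ∧ r ∉ suf := by
    rw [List.nodup_append, List.nodup_cons] at h
    exact ⟨fun hr => h.2.2 r hr r (by simp) rfl, h.2.1.1⟩
  have h2 : ∀ l : List ι, r ∉ l → l.map (rootRow e r) = bits (l.map (e r)) := fun l hl => by
    rw [bits, List.map_map]
    exact List.map_congr_left fun j hj => if_neg (show j ≠ r from fun hjr => hl (hjr ▸ hj))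
  simp only [List.map_append, List.map_cons, h2 _ h1.1, h2 _ h1.2]
  rw [List.set_append_right _ _ (by simp)]
  simp [rootRow]

/-- The outcome after trying out the roots in `rs`, where `ρ` is the outcome found before. -/
def tryRoots (ρ : Bool) (rs : List ι) : Bool :=
  rs.foldl (fun ρ r => if crossTest e vs (rootRow e r) vs then
    winTest wt e vs (wt r) (rootRow e r) else ρ) ρ

/-- If all roots that pass the test lead to the same outcome, and some root passes it, then this
outcome is found. -/
theorem tryRoots_eq {b : Bool} (rs : List ι)
    (h : ∀ r ∈ rs, crossTest e vs (rootRow e r) vs = true → winTest wt e vs (wt r) (rootRow e r) = b)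
    (ρ : Bool) (h' : ρ = b ∨ ∃ r ∈ rs, crossTest e vs (rootRow e r) vs = true) :
    tryRoots wt e vs ρ rs = b := by
  induction rs generalizing ρ with
  | nil => simpa [tryRoots] using h'
  | cons r rs ih =>
    refine ih (fun r hr => h r (by simp [hr])) _ ?_
    by_cases hc : crossTest e vs (rootRow e r) vs = true
    · exact .inl ((if_pos hc).trans (h r (by simp) hc))
    · dsimp only
      rw [if_neg hc]
      refine h'.imp_right ?_
      rintro ⟨r', hr', h1⟩
      rcases List.mem_cons.1 hr' with rfl | hr'
      · exact absurd h1 hc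
      · exact ⟨r', hr', h1⟩

theorem rootBody_loop_does {N : ℕ} (hN : ∀ j, (wt j).length + vs.length ≤ N)
    (hbN : (blocks wt (fun i => vs.map (e i)) vs).length ≤ N) (hvs : vs.Nodup) (rs : List ι)
    (pre : List ι) (hpre : vs = pre ++ rs) (ρ : Bool) :
    Does (.loop .l1 none rootBody) {
        l1 := blocks wt (fun i => vs.map (e i)) rs, l2 := blocks wt (fun i => vs.map (e i)) vs
        l3 := blocks wt (fun i => vs.map (e i)) vs, u := List.replicate pre.length .blank
        v := {res := ρ}} {
        l2 := blocks wt (fun i => vs.map (e i)) vs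
        l3 := blocks wt (fun i => vs.map (e i)) vs, u := List.replicate vs.length .blank
        v := {res := tryRoots wt e vs ρ rs}}
      (rs.length * (N * (N * (10 * N + 25) + 50 * N + 53) + 40 * N + 51) + 1) := by
  induction rs generalizing pre ρ with
  | nil =>
    refine ((Does.loop_nil (k := .l1) rfl).mono (by simp)).congr ?_
    rw [List.append_nil] at hpre
    simp [hpre, tryRoots, blocks]
  | cons r rs ih =>
    rw [blocks_cons]
    have h1 := rootBody_does wt e vs (rootRow e r) (k := pre.length) hN {
        l1 := bits (wt r) ++ .comma :: (bits (vs.map (e r)) ++ .ket ::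
          blocks wt (fun i => vs.map (e i)) rs), l2 := blocks wt (fun i => vs.map (e i)) vs
        l3 := blocks wt (fun i => vs.map (e i)) vs, u := List.replicate pre.length .blank
        v := {res := ρ}} r rfl
      (by rw [hpre]; exact set_blank_eq_map_rootRow e pre rs r (hpre ▸ hvs)) rfl rfl
      (by rw [hpre]; simp) hbN rfl
    have h2 := ih (pre ++ [r]) (by simp [hpre]) (if crossTest e vs (rootRow e r) vs then
      winTest wt e vs (wt r) (rootRow e r) else ρ)
    rw [List.length_append, List.length_singleton] at h2
    refine (Does.loop_cons (k := .l1) rfl h1 h2).mono ?_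
    rw [List.length_cons, add_mul]
    omega

/-- A bound for the running time of the program on an input of length `N`. -/
def solveTime (N : ℕ) : ℕ :=
  N * (N * (N * (10 * N + 25) + 50 * N + 53) + 40 * N + 51) + 10 * N + 10

theorem solve_does (hvs : vs.Nodup) (hmem : ∀ j, j ∈ vs) :
    Does solve {inp := blocks wt (fun i => vs.map (e i)) vs}
      {v := {res := tryRoots wt e vs false vs}}
      (solveTime (blocks wt (fun i => vs.map (e i)) vs).length) := by
  obtain ⟨B, hB⟩ : ∃ B, B = blocks wt (fun i => vs.map (e i)) vs := ⟨_, rfl⟩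
  obtain ⟨hv, hw⟩ := length_le_length_blocks wt vs fun i => vs.map (e i)
  have h3 := rootBody_loop_does wt e vs (N := B.length)
    (fun j => by simpa [hB] using hw j (hmem j)) (by rw [hB]) hvs vs [] rfl false
  rw [← hB] at h3 hv ⊢
  have h1 : Does (copy .inp none [.t]) {inp := B} {t := B.reverse} (2 * B.length + 1) :=
    (Does.copy_all (l := B) rfl).congr (by simp [Mem.pushAll, Mem.set, Mem.get])
  have h2 : Does (copy .t none [.l1, .l2, .l3]) {t := B.reverse} {l1 := B, l2 := B, l3 := B}
      (2 * B.length + 1) :=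
    ((Does.copy_all (l := B.reverse) rfl).mono (by simp)).congr
      (by simp [Mem.pushAll, Mem.set, Mem.get])
  have h4 := ((Does.copy_all (k := .l2) (ds := []) (l := B) (s := {
      l2 := B, l3 := B, u := List.replicate vs.length .blank
      v := {res := tryRoots wt e vs false vs}}) rfl).seq
    ((Does.copy_all (k := .l3) (ds := []) (l := B) rfl).seq
    (Does.copy_all (k := .u) (ds := []) (l := List.replicate vs.length .blank) rfl)))
  refine ((h1.seq (h2.seq (h3.seq h4))).mono ?_).congr ?_
  · rw [solveTime, List.length_replicate]
    have := Nat.mul_le_mul_right (B.length * (B.length * (10 * B.length + 25) + 50 * B.length + 53) +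
      40 * B.length + 51) hv
    omega
  · simp [Mem.pushAll, Mem.set]

end Solve

/-! ### Correctness of the program -/

theorem nextWins_iff_not_prevWins (w A e B : ℕ) :
    Reg.nextWins {
      fy := decide (e < w), fz := decide (A < w), pQ := (A + e + B).bodd
      pA := A.bodd, pB := B.bodd, pw := w.bodd } = true ↔ ¬ PrevWins w A e B := by
  simp only [Reg.nextWins, PrevWins, Nat.mod_two_of_bodd]
  by_cases h : e < w
  · cases (A + e + B).bodd <;> simp [h]
  · by_cases h' : A < w <;> cases A.bodd <;> cases B.bodd <;> cases w.bodd <;> simp [h, h']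

namespace LoopGraph

variable {n : ℕ} {G : LoopGraph (Fin n)} {r : Fin n}

theorem isOne_rootRow (hr : G.adj r r = false) (j : Fin n) :
    isOne (some (rootRow G.adj r j)) = G.adj r j := by
  unfold rootRow
  split_ifs with h
  · rw [h, hr]
    rfl
  · rfl

theorem crossTest_iff (hr : G.adj r r = false) :
    crossTest G.adj (List.finRange n) (rootRow G.adj r) (List.finRange n) = true ↔
      ∀ u v, G.adj u v = true → G.adj r u ≠ G.adj r v := by
  simp [crossTest, isOne_rootRow hr, imp_iff_not_or]

variable (ω : Fin n → ℕ)

theorem IsCenter.belowSum_eq (hc : G.IsCenter r) {i : Fin n} (hi : G.adj r i = true) :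
    belowSum (fun i => encodeNat (ω i)) (G.adj i) (rootRow G.adj r) (List.finRange n) =
      G.below r ω i := by
  rw [belowSum, below, Fin.sum_univ_def]
  congr 1
  refine List.map_congr_left fun j _ => ?_
  simp only [leafWeight, val_encodeNat, rootRow]
  cases h : G.adj i j
  · simp
  · have hj : G.adj r j = false := by
      have := hc.cross i j h
      rw [hi] at this
      simpa using this.symm
    by_cases hjr : j = r <;> simp [hjr, hj]

theorem IsCenter.childSum_eq (hc : G.IsCenter r) (f : ℕ → ℕ → ℕ) :
    childSum (fun i => encodeNat (ω i)) G.adj (List.finRange n) f (rootRow G.adj r)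
      (List.finRange n) = ∑ i ∈ G.children r, f (ω i) (G.below r ω i) := by
  rw [childSum, children, Finset.sum_filter, Fin.sum_univ_def]
  congr 1
  refine List.map_congr_left fun i _ => ?_
  rw [isOne_rootRow hc.not_mem_children_self, val_encodeNat]
  split_ifs with hi
  · rw [hc.belowSum_eq ω hi]
  · rfl

theorem IsCenter.winTest_iff (hc : G.IsCenter r) :
    winTest (fun i => encodeNat (ω i)) G.adj (List.finRange n) (encodeNat (ω r))
      (rootRow G.adj r) = true ↔ G.NextPlayerWins ω := by
  rw [hc.nextPlayerWins_iff, PrevWinsOn, ← nextWins_iff_not_prevWins, winTest]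
  simp only [hc.childSum_eq, val_encodeNat, ← Finset.sum_add_distrib]
  have h : ∀ a b : ℕ, freePart a b + (a - b) + leafPart a b = a := fun a b => by
    unfold freePart leafPart
    split_ifs <;> omega
  simp only [h]

end LoopGraph

theorem Instance.encode_eq_blocks (I : Instance) : I.encode =
    blocks (fun i => encodeNat (I.weight i)) (fun i => (List.finRange I.n).map (I.graph.adj i))
      (List.finRange I.n) := by
  simp only [Instance.encode, blocks, block, bits, List.map_map]
  rfl

open Classical in
theorem outcome_encode {V : Type} [Fintype V] [DecidableEq V] (G : LoopGraph V) (ω : V → ℕ) :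
    (outcome G ω).encode = [decide (G.NextPlayerWins ω)] := by
  unfold outcome
  by_cases h : G.NextPlayerWins ω <;> simp [h, Outcome.encode]

open Classical in
theorem tryRoots_eq_nextPlayerWins (T : DepthTwoTree) :
    tryRoots (fun i => encodeNat (T.1.weight i)) T.1.graph.adj (List.finRange T.1.n) false
      (List.finRange T.1.n) = decide (T.1.graph.NextPlayerWins T.1.weight) := by
  obtain ⟨I, hG, hd⟩ := T
  refine tryRoots_eq _ _ _ _ (fun r _ hr => ?_) _ (.inr ?_)
  · rw [LoopGraph.crossTest_iff (hG.1 r)] at hr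
    rw [Bool.eq_iff_iff, (LoopGraph.isCenter_of_isTree hG hr).winTest_iff, decide_eq_true_iff]
  · obtain ⟨r, hr⟩ := LoopGraph.exists_cross_of_hasDepthAtMost hG hd
    exact ⟨r, List.mem_finRange r, (LoopGraph.crossTest_iff (hG.1 r)).2 hr⟩

end WAK

theorem theorem1 :
    Nonempty (Turing.TM2ComputableInPolyTime
      (fun T : WAK.DepthTwoTree => T.1.encode)
      WAK.Outcome.encode
      (fun T : WAK.DepthTwoTree => WAK.outcome T.1.graph T.1.weight)) := by
  refine WAK.solve.computableInPolyTime _ _ _ (open Polynomial in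
    X * (X * (X * (10 * X + 25) + 50 * X + 53) + 40 * X + 51) + 10 * X + 10) fun T => ?_
  obtain ⟨tm, h⟩ := WAK.solve_does (fun i => Computability.encodeNat (T.1.weight i)) T.1.graph.adj
    (List.finRange T.1.n) (List.nodup_finRange _) List.mem_finRange {}
  rw [← WAK.Instance.encode_eq_blocks, WAK.tryRoots_eq_nextPlayerWins] at h
  refine ⟨_, ?_, h.mono (le_of_eq ?_)⟩
  · exact WAK.outcome_encode _ _
  · simp [WAK.solveTime]
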